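/- For positive integers $n,k$, a $k$-CRV is a random vector in $\mathbb{R}^k$ supported on the set $\{e_1,\dots,e_k\}$ of standard unit vectors, and an $(n,k)$-PMD is a random vector of the form $\sum_{i=1}^n X_i$ with $X_1,\dots,X_n$ independent $k$-CRVs. Let $d_{\mathrm{TV}}(X,Y)=\sup_S|\Pr[X\in S]-\Pr[Y\in S]|$ denote total variation distance and let $\log$ be the natural logarithm. There is a universal constant $C>0$ such that the following holds. Let $n,k\in\mathbb{Z}_+$ with $k>2$, and let $0<\epsilon<k/e$ (so that $\log\log(k/\epsilon)>0$; every $\epsilon\in(0,1]$ is allowed). For every $(n,k)$-PMD $X$ there is an $(n,k)$-PMD $Y$ with $d_{\mathrm{TV}}(X,Y)\le\epsilon$ that can be written as $Y=\sum_{i=1}^n Y_i$ with $Y_1,\dots,Y_n$ independent $k$-CRVs whose distributions take at most $$\left(C\left(\frac{\log(k/\epsilon)}{\log\log(k/\epsilon)}+k\right)\right)^k$$ distinct values. -/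

import Mathlib

open MeasureTheory ProbabilityTheory

noncomputable section

/-- A `k`-categorical random variable: a random vector in `ℝ^k` that almost surely takes one of
the values `e_1, …, e_k` (the standard unit vectors). -/
def IsCRV {Ω : Type*} [MeasurableSpace Ω] {k : ℕ} (X : Ω → Fin k → ℝ) (μ : Measure Ω) : Prop :=
  Measurable X ∧ ∀ᵐ ω ∂μ, ∃ j : Fin k, X ω = Pi.single j 1

/-- `X = ∑ i, Z i` where `Z 0, …, Z (n - 1)` are independent `k`-categorical random variables. -/
structure IsPMDDecomposition {Ω : Type*} [MeasurableSpace Ω] {n k : ℕ} (X : Ω → Fin k → ℝ)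
    (Z : Fin n → Ω → Fin k → ℝ) (μ : Measure Ω) : Prop where
  isCRV : ∀ i, IsCRV (Z i) μ
  indep : iIndepFun Z μ
  eq_sum : X = ∑ i, Z i

/-- `X` is an `(n, k)`-Poisson multinomial random vector. -/
def IsPMD {Ω : Type*} [MeasurableSpace Ω] (n : ℕ) {k : ℕ} (X : Ω → Fin k → ℝ)
    (μ : Measure Ω) : Prop :=
  ∃ Z : Fin n → Ω → Fin k → ℝ, IsPMDDecomposition X Z μ

/-- Total variation distance `sup_S |P S - Q S|`, over measurable sets `S`, of two finite
measures (the supremum is then of a bounded nonempty family). -/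
def tvDist {α : Type*} [MeasurableSpace α] (P Q : Measure α) : ℝ :=
  ⨆ S : {S : Set α // MeasurableSet S}, |P.real S - Q.real S|

end

/-! Write `L = log (k / ε)`. A PMD is determined by its rows of probabilities, and its law is read
off the coefficients of the product of the linear forms of the rows (`linForm`). Total variation
distance is thus bounded by the sum of absolute values of the coefficients of a difference of two
such products (`tvDist_multinomialLaw_le`), a norm that is submultiplicative. Every row has a
coordinate of mass at least `1 / k`, so the rows split into `k` groups, each with a common heavy
coordinate `o`; it suffices to lose `exp (-L)` in each group (`exists_few_values_le_mul`).

Analytic half: if two families of rows in a group share all moments up to degree `m`, of order `L /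
log L + k`, their products are close (`coeffNorm_prod_linForm_sub_le`). Coefficients are Fourier
integrals over the torus. Where the phases of all heavy columns are small, the logarithms of the two
products have equal Taylor polynomials of degree `m`; elsewhere both products are tiny because of
the mass at `o`. This needs every column to be heavy or uniformly small, which holds after setting
aside a number of rows polynomial in `k` and `L` (`exists_subset_light_or_small`).

Algebraic half: any family of rows in a box slice of the simplex has the same moments up to degree
`m` as a family with at most `(3 m) ^ k` distinct rows (`exists_few_values_same_moments`). Minimise
the moment discrepancy plus a small multiple of the power sums of degree `m + 1` of partial sums.
Stationarity makes all rows of the minimiser with the same active box constraints satisfy common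
polynomial equations whose leading terms are pure powers `t j ^ m`, and a Bézout-type count bounds
the solutions by `m ^ k`. Compactness then lets the regularisation tend to zero. -/

/-! ### Counting the points of a finite set that satisfies pure-power polynomial relations. -/

lemma pow_span_insert_one_le_span_monomials {S ι : Type*} [Fintype ι] (t : ι → S → ℝ) (D : ℕ) :
    Submodule.span ℝ (insert 1 (Set.range t)) ^ D ≤
      Submodule.span ℝ {f : S → ℝ | ∃ a : ι → ℕ, ∑ j, a j ≤ D ∧ f = ∏ j, t j ^ a j} := by
  classical
  induction D with
  | zero =>
    rw [pow_zero, Submodule.one_le]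
    exact Submodule.subset_span ⟨0, by simp, by simp⟩
  | succ D ih =>
    rw [pow_succ]
    refine (mul_le_mul' ih le_rfl).trans ?_
    rw [Submodule.span_mul_span]
    refine Submodule.span_mono ?_
    rintro _ ⟨_, ⟨a, ha, rfl⟩, g, hg, rfl⟩
    rcases hg with rfl | ⟨j, rfl⟩
    · exact ⟨a, by omega, by simp⟩
    · refine ⟨a + Pi.single j 1, ?_, ?_⟩
      · simp [Finset.sum_add_distrib]
        omega
      · simp only [Pi.add_apply, pow_add, Finset.prod_mul_distrib, Pi.single_apply]
        simp

lemma prod_pow_mem_pow {A ι : Type*} [CommRing A] [Algebra ℝ A] (V : Submodule ℝ A)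
    (s : Finset ι) (t : ι → A) (ht : ∀ j ∈ s, t j ∈ V) (a : ι → ℕ) :
    ∏ j ∈ s, t j ^ a j ∈ V ^ (∑ j ∈ s, a j) := by
  classical
  induction s using Finset.induction_on with
  | empty => simpa using Submodule.one_le.1 (le_refl (1 : Submodule ℝ A))
  | insert i s hi ih =>
    rw [Finset.prod_insert hi, Finset.sum_insert hi, pow_add]
    exact Submodule.mul_mem_mul (Submodule.pow_mem_pow _ (ht i (by simp)) _)
      (ih fun j hj => ht j (by simp [hj]))

lemma pow_le_pow_of_one_mem {A : Type*} [CommRing A] [Algebra ℝ A] {V : Submodule ℝ A}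
    (h1 : (1 : A) ∈ V) {a b : ℕ} (hab : a ≤ b) : V ^ a ≤ V ^ b :=
  pow_le_pow_right' (Submodule.one_le.2 h1) hab

/-- If separating coordinate functions on a finite set satisfy monic relations
`t j ^ m ∈ (polynomials in t of degree < m)`, then the set has at most `m ^ |ι|` points. -/
lemma card_le_pow_of_pow_mem {S ι : Type*} [Fintype S] [Fintype ι] (t : ι → S → ℝ)
    (V : Submodule ℝ (S → ℝ)) (hV : V = Submodule.span ℝ (insert 1 (Set.range t)))
    {m : ℕ} (hm : 1 ≤ m) (ht : ∀ j, t j ^ m ∈ V ^ (m - 1))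
    (hsep : ∀ s s' : S, (∀ j, t j s = t j s') → s = s') :
    Fintype.card S ≤ m ^ Fintype.card ι := by
  classical
  set b : (ι → Fin m) → S → ℝ := fun a => ∏ j, t j ^ (a j : ℕ) with hb
  set W : Submodule ℝ (S → ℝ) := Submodule.span ℝ (Set.range b) with hW
  have h1V : (1 : S → ℝ) ∈ V := hV ▸ Submodule.subset_span (by simp)
  have htV : ∀ j, t j ∈ V := fun j => hV ▸ Submodule.subset_span (by simp)
  -- `V ^ D` stands for the polynomials of degree at most `D` in `t`. Replacing a factor `t i ^ m`
  -- by an element of `V ^ (m - 1)` lowers the total degree, so every monomial reduces to exponents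
  -- below `m`.
  have key : ∀ D, V ^ D ≤ W := by
    intro D
    induction D using Nat.strong_induction_on with
    | _ D ih =>
      rw [hV]
      refine (pow_span_insert_one_le_span_monomials t D).trans (Submodule.span_le.2 ?_)
      rintro _ ⟨a, ha, rfl⟩
      by_cases h : ∀ j, a j < m
      · exact Submodule.subset_span ⟨fun j => ⟨a j, h j⟩, rfl⟩
      · push Not at h
        obtain ⟨i, hi⟩ := h
        have hai : a i ≤ ∑ j, a j := Finset.single_le_sum (fun _ _ => Nat.zero_le _)
          (Finset.mem_univ i)
        have hsum : ∑ j, (a - (Pi.single i m : ι → ℕ)) j + m = ∑ j, a j := by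
          have : ∀ j, a j = (a - (Pi.single i m : ι → ℕ)) j + (Pi.single i m : ι → ℕ) j := by
            intro j
            by_cases hj : j = i
            · subst hj; simp; omega
            · simp [hj]
          rw [Finset.sum_congr rfl fun j _ => this j, Finset.sum_add_distrib]
          simp
        have hprod : ∏ j, t j ^ a j = (∏ j, t j ^ (a - (Pi.single i m : ι → ℕ)) j) * t i ^ m := by
          rw [← Finset.mul_prod_erase _ _ (Finset.mem_univ i),
            ← Finset.mul_prod_erase Finset.univ
              (fun j => t j ^ (a - (Pi.single i m : ι → ℕ) : ι → ℕ) j)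
              (Finset.mem_univ i), mul_right_comm]
          congr 1
          · simp [← pow_add, Nat.sub_add_cancel hi]
          · refine Finset.prod_congr rfl fun j hj => ?_
            simp [Finset.ne_of_mem_erase hj]
        refine ih (D - 1) (by omega) ?_
        rw [hprod]
        have := Submodule.mul_mem_mul
          (prod_pow_mem_pow V Finset.univ t (fun j _ => htV j) (a - (Pi.single i m : ι → ℕ))) (ht i)
        rw [← pow_add] at this
        exact pow_le_pow_of_one_mem h1V (by omega) this
  -- Interpolation: separation by `t` makes each point indicator a product of affine functions of
  -- `t`. The reduced monomials therefore span all functions on `S`, a space of dimension `card S`.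
  have htop : W = ⊤ := by
    rw [eq_top_iff]
    intro f _
    have hind : ∀ s : S, (Pi.single s (1 : ℝ) : S → ℝ) ∈ W := by
      intro s
      have hex : ∀ s' : S, ∃ g ∈ V, g s = 1 ∧ (s' ≠ s → g s' = 0) := by
        intro s'
        by_cases hs : s' = s
        · exact ⟨1, h1V, by simp, fun h => absurd hs h⟩
        · obtain ⟨j, hj⟩ : ∃ j, t j s' ≠ t j s := by
            by_contra! hcon
            exact hs (hsep _ _ hcon)
          have hne : t j s - t j s' ≠ 0 := sub_ne_zero.2 (Ne.symm hj)
          refine ⟨(t j s - t j s')⁻¹ • (t j - t j s' • (1 : S → ℝ)),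
            V.smul_mem _ (V.sub_mem (htV j) (V.smul_mem _ h1V)), ?_, fun _ => by simp⟩
          simp [hne]
      choose g hgV hg1 hg0 using hex
      have : (Pi.single s (1 : ℝ) : S → ℝ) = ∏ s' : S, g s' ^ 1 := by
        ext x
        simp only [pow_one, Finset.prod_apply]
        by_cases hx : x = s
        · subst hx; simp [hg1]
        · rw [Pi.single_eq_of_ne hx]
          exact (Finset.prod_eq_zero (f := fun s' => g s' x) (Finset.mem_univ x) (hg0 x hx)).symm
      rw [this]
      exact key _ (prod_pow_mem_pow V Finset.univ g (fun j _ => hgV j) (fun _ => 1))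
    have : f = ∑ s, f s • (Pi.single s (1 : ℝ) : S → ℝ) := by
      ext x; simp [Finset.sum_apply, Pi.single_apply]
    rw [this]
    exact Submodule.sum_mem _ fun s _ => W.smul_mem _ (hind s)
  have h := finrank_range_le_card (R := ℝ) b
  rw [Set.finrank, ← hW, htop, finrank_top, Module.finrank_fintype_fun_eq_card] at h
  simpa using h

lemma add_const_pow_sub_pow_mem {A : Type*} [CommRing A] [Algebra ℝ A] {V : Submodule ℝ A}
    (h1 : (1 : A) ∈ V) {t : A} (ht : t ∈ V) (c : ℝ) (m : ℕ) :
    (t + c • (1 : A)) ^ (m + 1) - t ^ (m + 1) ∈ V ^ m := by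
  induction m with
  | zero => simpa using Submodule.smul_mem _ c (Submodule.one_le.1 (le_refl (1 : Submodule ℝ A)))
  | succ m ih =>
    have : (t + c • (1 : A)) ^ (m + 1 + 1) - t ^ (m + 1 + 1) =
        ((t + c • (1 : A)) ^ (m + 1) - t ^ (m + 1)) * t + c • (t + c • (1 : A)) ^ (m + 1) := by
      simp only [Algebra.smul_def, mul_one]; ring
    rw [this]
    refine Submodule.add_mem _ ?_ (Submodule.smul_mem _ _ ?_)
    · rw [pow_succ V]; exact Submodule.mul_mem_mul ih ht
    · exact Submodule.pow_mem_pow _ (V.add_mem ht (V.smul_mem _ h1)) _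

/-- The partial sum `x 0 + ⋯ + x j`. -/
def partialSum {k : ℕ} (x : Fin k → ℝ) (j : Fin k) : ℝ := ∑ i ∈ Finset.Iic j, x i

/-- Only the coordinates in `σ` vary over `S`. Between consecutive varying coordinates `j < j'`, all
partial sums differ from the one at `j` by constants, so the relation for that pair has leading term
`(j' - j) * partialSum j ^ m`. Partial sums thus turn the relations into the pure-power form needed
for the count. -/
lemma card_le_pow_of_partialSum_relation {k m : ℕ} (hm : 1 ≤ m) (S : Finset (Fin k → ℝ))
    (σ : Fin k → Prop) (hconst : ∀ x ∈ S, ∀ y ∈ S, ∀ j, ¬ σ j → x j = y j)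
    (hsum : ∀ x ∈ S, ∑ j, x j = 1)
    (hcrit : ∀ j j', j < j' → σ j → σ j' →
      (fun s : S => ∑ a ∈ Finset.Ico j j', partialSum (s : Fin k → ℝ) a ^ m) ∈
        Submodule.span ℝ (insert 1 (Set.range fun (i : Fin k) (s : S) => (s : Fin k → ℝ) i)) ^
          (m - 1)) :
    S.card ≤ m ^ k := by
  classical
  rcases S.eq_empty_or_nonempty with rfl | ⟨x0, hx0⟩
  · simp
  set V := Submodule.span ℝ (insert 1 (Set.range fun (i : Fin k) (s : S) => (s : Fin k → ℝ) i))
    with hVdef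
  -- The last varying coordinate gets no variable of its own: the constraint of total sum one
  -- recovers it.
  let ι := {j : Fin k // σ j ∧ ∃ j', j < j' ∧ σ j'}
  let t : ι → S → ℝ := fun j s => partialSum (s : Fin k → ℝ) j
  set V' := Submodule.span ℝ (insert 1 (Set.range t)) with hV'def
  have h1V : (1 : S → ℝ) ∈ V := Submodule.subset_span (by simp)
  have h1V' : (1 : S → ℝ) ∈ V' := Submodule.subset_span (by simp)
  have hxV : ∀ i, (fun s : S => (s : Fin k → ℝ) i) ∈ V := fun i =>
    Submodule.subset_span (by simp)
  have htV' : ∀ j, t j ∈ V' := fun j => Submodule.subset_span (by simp)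
  have hpV : ∀ j, (fun s : S => partialSum (s : Fin k → ℝ) j) ∈ V := by
    intro j
    have : (fun s : S => partialSum (s : Fin k → ℝ) j) =
        ∑ i ∈ Finset.Iic j, fun s : S => (s : Fin k → ℝ) i := by
      ext s; simp [partialSum, Finset.sum_apply]
    rw [this]
    exact Submodule.sum_mem _ fun i _ => hxV i
  have hxV' : ∀ i, (fun s : S => (s : Fin k → ℝ) i) ∈ V' := by
    intro i
    induction i using WellFoundedLT.induction with
    | _ i ih =>
      by_cases hi : σ i
      · by_cases hn : ∃ j', i < j' ∧ σ j'
        · have : (fun s : S => (s : Fin k → ℝ) i) =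
              t ⟨i, hi, hn⟩ - ∑ a ∈ Finset.Iio i, fun s : S => (s : Fin k → ℝ) a := by
            ext s
            simp only [t, partialSum, Pi.sub_apply, Finset.sum_apply]
            rw [← Finset.Iio_insert, Finset.sum_insert (by simp)]
            ring
          rw [this]
          exact V'.sub_mem (htV' _) (V'.sum_mem fun a ha => ih a (Finset.mem_Iio.1 ha))
        · push Not at hn
          have : (fun s : S => (s : Fin k → ℝ) i) =
              (1 - ∑ a ∈ Finset.Ioi i, x0 a) • (1 : S → ℝ) -
                ∑ a ∈ Finset.Iio i, fun s : S => (s : Fin k → ℝ) a := by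
            ext s
            have h1 : ∑ a ∈ Finset.Ioi i, (s : Fin k → ℝ) a = ∑ a ∈ Finset.Ioi i, x0 a :=
              Finset.sum_congr rfl fun a ha =>
                hconst _ s.2 _ hx0 a (hn a (Finset.mem_Ioi.1 ha))
            have h2 := hsum _ s.2
            have h3 : (Finset.univ : Finset (Fin k)) = insert i (Finset.Iio i) ∪ Finset.Ioi i := by
              ext a
              simp only [Finset.mem_univ, Finset.mem_union, Finset.mem_insert, Finset.mem_Iio,
                Finset.mem_Ioi, true_iff]
              rcases lt_trichotomy a i with h | h | h <;> simp [h]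
            have h4 : Disjoint (insert i (Finset.Iio i)) (Finset.Ioi i) := by
              rw [Finset.disjoint_left]
              intro a ha hb
              simp only [Finset.mem_insert, Finset.mem_Iio, Finset.mem_Ioi] at ha hb
              rcases ha with rfl | ha
              · exact lt_irrefl _ hb
              · exact lt_asymm ha hb
            rw [h3, Finset.sum_union h4, Finset.sum_insert (by simp)] at h2
            simp only [Pi.sub_apply, Pi.smul_apply, Pi.one_apply, smul_eq_mul, mul_one,
              Finset.sum_apply]
            linarith
          rw [this]
          exact V'.sub_mem (V'.smul_mem _ h1V') (V'.sum_mem fun a ha => ih a (Finset.mem_Iio.1 ha))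
      · have : (fun s : S => (s : Fin k → ℝ) i) = x0 i • (1 : S → ℝ) := by
          ext s; simpa using hconst _ s.2 _ hx0 i hi
        rw [this]
        exact V'.smul_mem _ h1V'
  -- Coordinates and selected partial sums span the same affine functions, so degree means the same
  -- in both systems.
  have hVV' : V = V' := by
    apply le_antisymm <;> rw [Submodule.span_le] <;> rintro f (rfl | ⟨i, rfl⟩)
    · exact h1V'
    · exact hxV' i
    · exact h1V
    · exact hpV i
  have hpow : ∀ j, t j ^ m ∈ V ^ (m - 1) := by
    rintro ⟨j, hj, hn⟩
    obtain ⟨j', ⟨hjj', hσ'⟩, hmin⟩ : ∃ j', (j < j' ∧ σ j') ∧ ∀ a, j < a → a < j' → ¬ σ a := by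
      obtain ⟨j', hj', hmin⟩ := WellFounded.has_min (wellFounded_lt (α := Fin k))
        {j' | j < j' ∧ σ j'} hn
      exact ⟨j', hj', fun a h1 h2 h3 => hmin a ⟨h1, h3⟩ h2⟩
    have h := hcrit j j' hjj' hj hσ'
    set T : S → ℝ := fun s => partialSum (s : Fin k → ℝ) j with hT
    have hterm : ∀ a ∈ Finset.Ico j j',
        (fun s : S => partialSum (s : Fin k → ℝ) a ^ m) - T ^ m ∈ V ^ (m - 1) := by
      intro a ha
      rw [Finset.mem_Ico] at ha
      have hdis : Disjoint (Finset.Iic j) (Finset.Ioc j a) := by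
        rw [Finset.disjoint_left]
        intro b hb hb'
        exact not_lt_of_ge (Finset.mem_Iic.1 hb) (Finset.mem_Ioc.1 hb').1
      have hun : Finset.Iic a = Finset.Iic j ∪ Finset.Ioc j a := by
        ext b
        simp only [Finset.mem_Iic, Finset.mem_union, Finset.mem_Ioc]
        constructor
        · intro hb
          rcases le_or_gt b j with h | h
          · exact Or.inl h
          · exact Or.inr ⟨h, hb⟩
        · rintro (hb | hb)
          · exact hb.trans ha.1
          · exact hb.2
      have heq : (fun s : S => partialSum (s : Fin k → ℝ) a ^ m) =
          (T + (∑ b ∈ Finset.Ioc j a, x0 b) • (1 : S → ℝ)) ^ m := by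
        ext s
        have : ∑ b ∈ Finset.Ioc j a, (s : Fin k → ℝ) b = ∑ b ∈ Finset.Ioc j a, x0 b :=
          Finset.sum_congr rfl fun b hb => by
            rw [Finset.mem_Ioc] at hb
            exact hconst _ s.2 _ hx0 b (hmin b hb.1 (lt_of_le_of_lt hb.2 ha.2))
        simp only [hT, partialSum, hun, Finset.sum_union hdis, this, Pi.pow_apply, Pi.add_apply,
          Pi.smul_apply, Pi.one_apply, smul_eq_mul, mul_one]
      rw [heq]
      obtain ⟨m', rfl⟩ : ∃ m', m = m' + 1 := ⟨m - 1, by omega⟩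
      exact add_const_pow_sub_pow_mem h1V (hpV j) _ m'
    have hN : (((Finset.Ico j j').card : ℝ)) ≠ 0 := by
      have : j ∈ Finset.Ico j j' := by simp [hjj']
      exact_mod_cast (Finset.card_pos.2 ⟨j, this⟩).ne'
    have h2 := Submodule.sub_mem _ h (Submodule.sum_mem _ hterm)
    have h3 : (fun s : S => ∑ a ∈ Finset.Ico j j', partialSum (s : Fin k → ℝ) a ^ m) -
        ∑ a ∈ Finset.Ico j j', ((fun s : S => partialSum (s : Fin k → ℝ) a ^ m) - T ^ m) =
        ((Finset.Ico j j').card : ℝ) • T ^ m := by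
      ext s
      simp [Finset.sum_apply]
    rw [h3] at h2
    have h4 := Submodule.smul_mem _ (((Finset.Ico j j').card : ℝ))⁻¹ h2
    rwa [smul_smul, inv_mul_cancel₀ hN, one_smul] at h4
  have hsep : ∀ s s' : S, (∀ j, t j s = t j s') → s = s' := by
    intro s s' hss
    have hle : V' ≤ LinearMap.ker
        ((LinearMap.proj s : (S → ℝ) →ₗ[ℝ] ℝ) - LinearMap.proj s') := by
      rw [Submodule.span_le]
      rintro f (rfl | ⟨j, rfl⟩)
      · simp
      · simpa [sub_eq_zero] using hss j
    ext i
    have := hle (hxV' i)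
    simpa [sub_eq_zero] using this
  have hcard := card_le_pow_of_pow_mem t V hVV' hm hpow hsep
  rw [Fintype.card_coe] at hcard
  refine hcard.trans (Nat.pow_le_pow_right hm ?_)
  exact (Fintype.card_subtype_le _).trans (by simp)

/-! ### Matching moments with few distinct rows, by a regularised minimisation. -/

/-- The slice of the box `∏ [l j, u j]` by the hyperplane of coordinate sum one. -/
def boxSimplex {k : ℕ} (l u : Fin k → ℝ) : Set (Fin k → ℝ) :=
  {x | (∀ j, l j ≤ x j ∧ x j ≤ u j) ∧ ∑ j, x j = 1}

/-- Power sum of the rows of `q` against the monomial given by the word `w`. -/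
def wordMoment {G : Type*} [Fintype G] {k m : ℕ} (q : G → Fin k → ℝ)
    (w : Σ r : Fin (m + 1), (Fin r → Fin k)) : ℝ :=
  ∑ i, ∏ t, q i (w.2 t)

/-- Moment discrepancy with respect to `p`, regularised by power sums of partial sums. -/
def momentPotential {G : Type*} [Fintype G] {k : ℕ} (m : ℕ) (p : G → Fin k → ℝ) (δ : ℝ)
    (q : G → Fin k → ℝ) : ℝ :=
  ∑ w : (Σ r : Fin (m + 1), (Fin r → Fin k)), (wordMoment q w - wordMoment p w) ^ 2 +
    δ * ∑ i, ∑ a, partialSum (q i) a ^ (m + 1)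

/-- Directional derivative of the word monomial `w` at `x`. -/
def wordDeriv {k m : ℕ} (w : Σ r : Fin (m + 1), (Fin r → Fin k)) (x v : Fin k → ℝ) : ℝ :=
  ∑ t, (∏ t' ∈ Finset.univ.erase t, x (w.2 t')) * v (w.2 t)

lemma hasDerivAt_wordMoment {G : Type*} [Fintype G] [DecidableEq G] {k m : ℕ}
    (q : G → Fin k → ℝ) (i0 : G) (v : Fin k → ℝ) (w : Σ r : Fin (m + 1), (Fin r → Fin k)) :
    HasDerivAt (fun h : ℝ => wordMoment (fun i a => q i a + h * if i = i0 then v a else 0) w)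
      (wordDeriv w (q i0) v) 0 := by
  have h1 : ∀ i a, HasDerivAt (fun h : ℝ => q i a + h * if i = i0 then v a else 0)
      (if i = i0 then v a else 0) 0 := by
    intro i a
    simpa using ((hasDerivAt_id (0 : ℝ)).mul_const (if i = i0 then v a else 0)).const_add (q i a)
  have h2 : HasDerivAt
      (fun h : ℝ => ∑ i, ∏ t, (q i (w.2 t) + h * if i = i0 then v (w.2 t) else 0)) _ 0 :=
    HasDerivAt.fun_sum fun i _ => HasDerivAt.fun_finsetProd fun t _ => h1 i (w.2 t)
  have h3 : (∑ i, ∑ t, (∏ t' ∈ Finset.univ.erase t,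
      (q i (w.2 t') + 0 * if i = i0 then v (w.2 t') else 0)) •
      (if i = i0 then v (w.2 t) else 0)) = wordDeriv w (q i0) v := by
    rw [Finset.sum_eq_single i0 (fun i _ hi => by simp [hi]) (by simp)]
    simp [wordDeriv]
  rw [h3] at h2
  exact h2

lemma hasDerivAt_momentPotential {G : Type*} [Fintype G] [DecidableEq G] {k : ℕ} (m : ℕ)
    (p : G → Fin k → ℝ) (δ : ℝ) (q : G → Fin k → ℝ) (i0 : G) (v : Fin k → ℝ) :
    HasDerivAt (fun h : ℝ => momentPotential m p δ
        (fun i a => q i a + h * if i = i0 then v a else 0))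
      (∑ w : (Σ r : Fin (m + 1), (Fin r → Fin k)),
          2 * (wordMoment q w - wordMoment p w) * wordDeriv w (q i0) v +
        δ * ∑ a, (m + 1) * partialSum (q i0) a ^ m * partialSum v a) 0 := by
  unfold momentPotential
  refine HasDerivAt.add (HasDerivAt.fun_sum fun w _ => ?_) (HasDerivAt.const_mul _ ?_)
  · have := ((hasDerivAt_wordMoment q i0 v w).sub_const (wordMoment p w)).fun_pow 2
    simpa using this
  · have hp : ∀ i a, HasDerivAt
        (fun h : ℝ => partialSum (fun b => q i b + h * if i = i0 then v b else 0) a)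
        (if i = i0 then partialSum v a else 0) 0 := by
      intro i a
      unfold partialSum
      have : HasDerivAt (fun h : ℝ => ∑ b ∈ Finset.Iic a, (q i b + h * if i = i0 then v b else 0))
          (∑ b ∈ Finset.Iic a, if i = i0 then v b else 0) 0 := by
        refine HasDerivAt.fun_sum fun b _ => ?_
        simpa using ((hasDerivAt_id (0 : ℝ)).mul_const (if i = i0 then v b else 0)).const_add
          (q i b)
      convert this using 1
      split_ifs <;> simp
    have h2 := HasDerivAt.fun_sum (u := Finset.univ) fun (i : G) _ =>
      HasDerivAt.fun_sum (u := Finset.univ) fun (a : Fin k) _ => (hp i a).fun_pow (m + 1)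
    have h3 : (∑ i, ∑ a, ((m + 1 : ℕ) : ℝ) *
        partialSum (fun b => q i b + 0 * if i = i0 then v b else 0) a ^ (m + 1 - 1) *
          if i = i0 then partialSum v a else 0) =
        ∑ a, (m + 1) * partialSum (q i0) a ^ m * partialSum v a := by
      rw [Finset.sum_eq_single i0 (fun i _ hi => by simp [hi]) (by simp)]
      simp
    rw [← h3]
    exact h2

/-- Words have length at most `m`, so the discrepancy contributes only degree `m - 1` to the
stationarity equation; the regulariser alone supplies its terms of degree `m`. -/
lemma wordDeriv_mem {k m : ℕ} (w : Σ r : Fin (m + 1), (Fin r → Fin k)) (hm : 1 ≤ m)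
    (v : Fin k → ℝ) (S : Finset (Fin k → ℝ)) :
    (fun s : S => wordDeriv w (s : Fin k → ℝ) v) ∈
      Submodule.span ℝ (insert 1 (Set.range fun (i : Fin k) (s : S) => (s : Fin k → ℝ) i)) ^
          (m - 1) := by
  set V := Submodule.span ℝ (insert 1 (Set.range fun (i : Fin k) (s : S) => (s : Fin k → ℝ) i))
  have h1V : (1 : S → ℝ) ∈ V := Submodule.subset_span (by simp)
  have : (fun s : S => wordDeriv w (s : Fin k → ℝ) v) =
      ∑ t, v (w.2 t) • ∏ t' ∈ Finset.univ.erase t, (fun s : S => (s : Fin k → ℝ) (w.2 t')) ^ 1 := by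
    ext s
    simp only [wordDeriv, Finset.sum_apply, Pi.smul_apply, Finset.prod_apply, pow_one, smul_eq_mul]
    exact Finset.sum_congr rfl fun t _ => mul_comm _ _
  rw [this]
  refine Submodule.sum_mem _ fun t _ => Submodule.smul_mem _ _ ?_
  refine pow_le_pow_of_one_mem h1V ?_ (prod_pow_mem_pow V _ _
    (fun t' _ => Submodule.subset_span (by simp)) (fun _ => 1))
  have := w.1.2
  simp
  omega

lemma partialSum_single_sub_single {k : ℕ} {j j' : Fin k} (h : j < j') (a : Fin k) :
    partialSum (Pi.single j 1 - Pi.single j' 1) a = if a ∈ Finset.Ico j j' then 1 else 0 := by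
  simp only [partialSum, Pi.sub_apply, Finset.sum_sub_distrib, Finset.mem_Ico]
  by_cases h1 : j ≤ a <;> by_cases h2 : j' ≤ a
  · simp [h1, h2, not_lt.2 h2]
  · simp [h1, h2, not_le.1 h2]
  · exact absurd (h.le.trans h2) h1
  · simp [h1, h2]

/-- First-order condition for moving mass between two interior coordinates of a single row, a move
that stays feasible in both directions. The coefficients `wordMoment q w - wordMoment p w` do not
depend on the row `i0`, so all rows obey the same equation. -/
lemma partialSum_relation_of_isMinOn {G : Type*} [Fintype G] {k m : ℕ}
    {l u : Fin k → ℝ} (p : G → Fin k → ℝ) {δ : ℝ} (q : G → Fin k → ℝ)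
    (hq : ∀ i, q i ∈ boxSimplex l u)
    (hmin : ∀ q' : G → Fin k → ℝ, (∀ i, q' i ∈ boxSimplex l u) →
      momentPotential m p δ q ≤ momentPotential m p δ q')
    (i0 : G) {j j' : Fin k} (hjj' : j < j') (hj : l j < q i0 j ∧ q i0 j < u j)
    (hj' : l j' < q i0 j' ∧ q i0 j' < u j') :
    δ * (m + 1) * ∑ a ∈ Finset.Ico j j', partialSum (q i0) a ^ m =
      - ∑ w : (Σ r : Fin (m + 1), (Fin r → Fin k)),
          2 * (wordMoment q w - wordMoment p w) *
            wordDeriv w (q i0) (Pi.single j 1 - Pi.single j' 1) := by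
  classical
  set v : Fin k → ℝ := Pi.single j 1 - Pi.single j' 1 with hv
  have hd := hasDerivAt_momentPotential m p δ q i0 v
  have hloc : IsLocalMin (fun h : ℝ => momentPotential m p δ
        (fun i a => q i a + h * if i = i0 then v a else 0)) 0 := by
    have hev : ∀ b : Fin k, (b = j ∨ b = j') → ∀ c : ℝ,
        ∀ᶠ h : ℝ in nhds 0, l b ≤ q i0 b + h * c ∧ q i0 b + h * c ≤ u b := by
      intro b hb c
      have hcont : Filter.Tendsto (fun h : ℝ => q i0 b + h * c) (nhds 0) (nhds (q i0 b)) := by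
        have : Continuous (fun h : ℝ => q i0 b + h * c) := by fun_prop
        simpa using this.tendsto 0
      have hb' : l b < q i0 b ∧ q i0 b < u b := by rcases hb with rfl | rfl <;> assumption
      filter_upwards [hcont.eventually_const_lt hb'.1, hcont.eventually_lt_const hb'.2] with h h1 h2
      exact ⟨h1.le, h2.le⟩
    filter_upwards [hev j (Or.inl rfl) (v j), hev j' (Or.inr rfl) (v j')] with h h1 h2
    have h0 : (fun i a => q i a + 0 * if i = i0 then v a else 0) = q := by ext; simp
    simp only [h0]
    refine hmin _ fun i => ?_
    by_cases hi : i = i0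
    · subst hi
      simp only [if_true]
      refine ⟨fun b => ?_, ?_⟩
      · by_cases hb : b = j
        · subst hb; exact h1
        · by_cases hb' : b = j'
          · subst hb'; exact h2
          · simpa [hv, hb, hb'] using (hq i).1 b
      · rw [Finset.sum_add_distrib, (hq i).2, ← Finset.mul_sum]
        simp [hv]
    · simpa [hi] using hq i
  have h0 := hloc.hasDerivAt_eq_zero hd
  simp only [hv, partialSum_single_sub_single hjj', mul_ite, mul_one, mul_zero,
    Finset.sum_ite_mem, Finset.univ_inter, ← Finset.mul_sum] at h0
  rw [mul_assoc]
  linarith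

lemma ncard_range_le_of_isMinOn {G : Type*} [Fintype G] {k m : ℕ} (hm : 1 ≤ m)
    {l u : Fin k → ℝ} (p : G → Fin k → ℝ) {δ : ℝ} (hδ : 0 < δ) (q : G → Fin k → ℝ)
    (hq : ∀ i, q i ∈ boxSimplex l u)
    (hmin : ∀ q' : G → Fin k → ℝ, (∀ i, q' i ∈ boxSimplex l u) →
      momentPotential m p δ q ≤ momentPotential m p δ q') :
    (Finset.univ.image q).card ≤ (3 * m) ^ k := by
  classical
  -- Each coordinate is at its lower bound, at its upper bound, or free: at most `3 ^ k` patterns,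
  -- each carrying at most `m ^ k` rows.
  let st : (Fin k → ℝ) → Fin k → Fin 3 := fun x j =>
    if x j = l j then 0 else if x j = u j then 1 else 2
  have key : ∀ b ∈ Finset.image st (Finset.univ.image q),
      ((Finset.univ.image q).filter fun x => st x = b).card ≤ m ^ k := by
    intro b _
    refine card_le_pow_of_partialSum_relation hm _ (fun j => b j = 2) ?_ ?_ ?_
    · intro x hx y hy j hj
      have hx' := congrFun (Finset.mem_filter.1 hx).2 j
      have hy' := congrFun (Finset.mem_filter.1 hy).2 j
      simp only [st] at hx' hy'
      split_ifs at hx' hy' with h1 h2 h3 h4 h5 h6 <;> simp_all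
      all_goals omega
    · intro x hx
      obtain ⟨i, _, rfl⟩ := Finset.mem_image.1 (Finset.mem_filter.1 hx).1
      exact (hq i).2
    · intro j j' hjj' hj hj'
      set S := (Finset.univ.image q).filter fun x => st x = b
      set V := Submodule.span ℝ
        (insert 1 (Set.range fun (i : Fin k) (s : S) => (s : Fin k → ℝ) i))
      have hint : ∀ i a, st (q i) a = 2 → l a < q i a ∧ q i a < u a := by
        intro i a h
        simp only [st] at h
        split_ifs at h with h1 h2
        · exact absurd h (by decide)
        · exact absurd h (by decide)
        exact ⟨lt_of_le_of_ne ((hq i).1 a).1 (Ne.symm h1), lt_of_le_of_ne ((hq i).1 a).2 h2⟩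
      have hne : δ * (m + 1) ≠ 0 := by positivity
      have heq : (fun s : S => ∑ a ∈ Finset.Ico j j', partialSum (s : Fin k → ℝ) a ^ m) =
          (δ * (m + 1))⁻¹ • -∑ w : (Σ r : Fin (m + 1), (Fin r → Fin k)),
          (2 * (wordMoment q w - wordMoment p w)) •
            fun s : S => wordDeriv w (s : Fin k → ℝ) (Pi.single j 1 - Pi.single j' 1) := by
        ext ⟨s, hs⟩
        have hs2 := (Finset.mem_filter.1 hs).2
        obtain ⟨i, _, rfl⟩ := Finset.mem_image.1 (Finset.mem_filter.1 hs).1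
        have := partialSum_relation_of_isMinOn p q hq hmin i hjj'
          (hint i j (by rw [hs2, hj])) (hint i j' (by rw [hs2, hj']))
        simp only [Pi.smul_apply, Pi.neg_apply, Finset.sum_apply, smul_eq_mul]
        rw [← this, inv_mul_cancel_left₀ hne]
      rw [heq]
      exact Submodule.smul_mem _ _ (Submodule.neg_mem _ (Submodule.sum_mem _ fun w _ =>
        Submodule.smul_mem _ _ (wordDeriv_mem w hm _ S)))
  refine (Finset.card_le_mul_card_image _ _ key).trans ?_
  rw [mul_pow, mul_comm]
  refine Nat.mul_le_mul_right _ ((Finset.card_le_univ _).trans ?_)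
  simp

lemma isCompact_boxSimplex {k : ℕ} (l u : Fin k → ℝ) : IsCompact (boxSimplex l u) := by
  have h : boxSimplex l u = Set.univ.pi (fun j => Set.Icc (l j) (u j)) ∩ {x | ∑ j, x j = 1} := by
    ext x; simp only [boxSimplex, Set.mem_ofPred_eq, Set.mem_inter_iff, Set.mem_pi, Set.mem_univ,
      true_imp_iff, Set.mem_Icc]
  rw [h]
  exact (isCompact_univ_pi fun j => isCompact_Icc).inter_right
    (isClosed_eq (by fun_prop) continuous_const)

lemma continuous_wordMoment {G : Type*} [Fintype G] {k m : ℕ}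
    (w : Σ r : Fin (m + 1), (Fin r → Fin k)) :
    Continuous fun q : G → Fin k → ℝ => wordMoment q w := by
  unfold wordMoment; fun_prop

lemma continuous_momentPotential {G : Type*} [Fintype G] {k : ℕ} (m : ℕ) (p : G → Fin k → ℝ)
    (δ : ℝ) : Continuous (momentPotential m p δ) := by
  unfold momentPotential partialSum
  have := fun w => continuous_wordMoment (G := G) (k := k) (m := m) w
  fun_prop

/-- Rows in a box slice of the simplex can be replaced, keeping all moments of degree at most
`m`, by rows of the same slice that take at most `(3 m) ^ k` distinct values. -/
theorem exists_few_values_same_moments {G : Type*} [Fintype G] {k m : ℕ} (hm : 1 ≤ m)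
    {l u : Fin k → ℝ} (hl : ∀ j, 0 ≤ l j) (p : G → Fin k → ℝ) (hp : ∀ i, p i ∈ boxSimplex l u) :
    ∃ q : G → Fin k → ℝ, (∀ i, q i ∈ boxSimplex l u) ∧ (Set.range q).ncard ≤ (3 * m) ^ k ∧
      ∀ r ≤ m, ∀ f : Fin r → Fin k, ∑ i, ∏ t, q i (f t) = ∑ i, ∏ t, p i (f t) := by
  classical
  rcases isEmpty_or_nonempty G with hG | ⟨⟨i0⟩⟩
  · exact ⟨p, hp, by rw [Set.range_eq_empty, Set.ncard_empty]; exact Nat.zero_le _, fun _ _ _ => rfl⟩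
  have hKc : IsCompact {q : G → Fin k → ℝ | ∀ i, q i ∈ boxSimplex l u} := by
    have := isCompact_univ_pi fun _ : G => isCompact_boxSimplex l u
    rwa [show Set.univ.pi (fun _ => boxSimplex l u) = _ from
      Set.ext fun q => Set.mem_univ_pi] at this
  set N := (3 * m) ^ k with hN
  -- Families of rows that factor through `N` labels. As a finite union of continuous images of
  -- compact sets this is compact, so the bound on the number of values survives the limit `δ → 0`.
  set D : Set (G → Fin k → ℝ) := ⋃ c : G → Fin N,
    (fun (r : Fin N → Fin k → ℝ) i => r (c i)) '' {r | ∀ i, r i ∈ boxSimplex l u} with hD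
  have hDc : IsCompact D := by
    refine isCompact_iUnion fun c => IsCompact.image ?_ (by fun_prop)
    have := isCompact_univ_pi fun _ : Fin N => isCompact_boxSimplex l u
    rwa [show Set.univ.pi (fun _ => boxSimplex l u) = _ from
      Set.ext fun q => Set.mem_univ_pi] at this
  have hDK : ∀ q ∈ D, ∀ i, q i ∈ boxSimplex l u := by
    intro q hq i
    obtain ⟨c, r, hr, rfl⟩ := Set.mem_iUnion.1 hq
    exact hr _
  have hDn : ∀ q ∈ D, (Set.range q).ncard ≤ N := by
    intro q hq
    obtain ⟨c, r, hr, rfl⟩ := Set.mem_iUnion.1 hq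
    have hsub : Set.range (fun i => r (c i)) ⊆ Set.range r := by
      rintro _ ⟨i, rfl⟩; exact ⟨_, rfl⟩
    refine (Set.ncard_le_ncard hsub (Set.finite_range r)).trans ?_
    rw [← Set.image_univ]
    exact (Set.ncard_image_le Set.finite_univ).trans (by simp [Set.ncard_univ])
  -- Compare the minimiser with `p` itself, whose discrepancy is zero. The regulariser of the
  -- minimiser is nonnegative because `0 ≤ l`, and is dropped.
  have happrox : ∀ δ > 0, ∃ q ∈ D, momentPotential m p 0 q ≤
      δ * ∑ i, ∑ a, partialSum (p i) a ^ (m + 1) := by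
    intro δ hδ
    obtain ⟨q, hqK, hq⟩ := hKc.exists_isMinOn ⟨p, hp⟩ (continuous_momentPotential m p δ).continuousOn
    have hcard := ncard_range_le_of_isMinOn hm p hδ q hqK fun q' hq' => hq hq'
    refine ⟨q, ?_, ?_⟩
    · have hfin : Nonempty ((Finset.univ.image q) ↪ Fin N) := by
        refine Function.Embedding.nonempty_of_card_le ?_
        simpa using hcard
      obtain ⟨e⟩ := hfin
      have hmem : ∀ i, q i ∈ Finset.univ.image q := fun i => by simp
      refine Set.mem_iUnion.2 ⟨fun i => e ⟨q i, hmem i⟩, fun a =>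
        if h : ∃ i, e ⟨q i, hmem i⟩ = a then q h.choose else q i0, ?_, ?_⟩
      · intro a
        dsimp only
        split_ifs
        · exact hqK _
        · exact hqK _
      · ext1 i
        have h : ∃ i', e ⟨q i', hmem i'⟩ = e ⟨q i, hmem i⟩ := ⟨i, rfl⟩
        dsimp only
        rw [dif_pos h]
        exact congrArg Subtype.val (e.injective h.choose_spec)
    · have h1 : momentPotential m p δ q ≤ momentPotential m p δ p := hq hp
      have h2 : 0 ≤ ∑ i, ∑ a, partialSum (q i) a ^ (m + 1) :=
        Finset.sum_nonneg fun i _ => Finset.sum_nonneg fun a _ => pow_nonneg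
          (Finset.sum_nonneg fun b _ => (hl b).trans ((hqK i).1 b).1) _
      have h3 := mul_nonneg hδ.le h2
      simp only [momentPotential, sub_self, ne_eq, OfNat.ofNat_ne_zero, not_false_eq_true,
        zero_pow, Finset.sum_const_zero, zero_add, zero_mul, add_zero] at h1 ⊢
      linarith
  obtain ⟨q1, hq1, -⟩ := happrox 1 one_pos
  obtain ⟨q, hqD, hq⟩ := hDc.exists_isMinOn ⟨q1, hq1⟩ (continuous_momentPotential m p 0).continuousOn
  have hzero : momentPotential m p 0 q ≤ 0 := by
    set A := ∑ i, ∑ a, partialSum (p i) a ^ (m + 1)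
    have hA : 0 ≤ A := Finset.sum_nonneg fun i _ => Finset.sum_nonneg fun a _ => pow_nonneg
          (Finset.sum_nonneg fun b _ => (hl b).trans ((hp i).1 b).1) _
    refine le_of_forall_pos_le_add fun η hη => ?_
    obtain ⟨q', hq', hle⟩ := happrox (η / (A + 1)) (by positivity)
    refine (hq hq').trans (hle.trans ?_)
    rw [zero_add, div_mul_eq_mul_div, div_le_iff₀ (by positivity)]
    nlinarith
  refine ⟨q, hDK q hqD, hDn q hqD, fun r hr f => ?_⟩
  simp only [momentPotential, zero_mul, add_zero] at hzero
  have h0 := (Finset.sum_eq_zero_iff_of_nonneg (fun w _ => sq_nonneg _)).1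
    (le_antisymm hzero (Finset.sum_nonneg fun w _ => sq_nonneg _)) ⟨⟨r, by omega⟩, f⟩
    (Finset.mem_univ _)
  exact sub_eq_zero.1 (pow_eq_zero_iff (two_ne_zero) |>.1 h0)

/-! ### The coefficient norm and generating polynomials. -/

/-- Sum of the absolute values of the coefficients. -/
noncomputable def coeffNorm {σ : Type*} (f : MvPolynomial σ ℝ) : ℝ := ∑ v ∈ f.support, |f.coeff v|

lemma coeffNorm_eq_sum {σ : Type*} (f : MvPolynomial σ ℝ) {s : Finset (σ →₀ ℕ)}
    (hs : f.support ⊆ s) : coeffNorm f = ∑ v ∈ s, |f.coeff v| :=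
  Finset.sum_subset hs fun v _ hv => by simp [MvPolynomial.notMem_support_iff.1 hv]

lemma coeffNorm_nonneg {σ : Type*} (f : MvPolynomial σ ℝ) : 0 ≤ coeffNorm f :=
  Finset.sum_nonneg fun _ _ => abs_nonneg _

lemma coeffNorm_add_le {σ : Type*} (f g : MvPolynomial σ ℝ) :
    coeffNorm (f + g) ≤ coeffNorm f + coeffNorm g := by
  classical
  rw [coeffNorm_eq_sum (f + g) MvPolynomial.support_add,
    coeffNorm_eq_sum f Finset.subset_union_left, coeffNorm_eq_sum g Finset.subset_union_right,
    ← Finset.sum_add_distrib]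
  exact Finset.sum_le_sum fun v _ => by rw [MvPolynomial.coeff_add]; exact abs_add_le _ _

lemma coeffNorm_zero {σ : Type*} : coeffNorm (0 : MvPolynomial σ ℝ) = 0 := by simp [coeffNorm]

lemma coeffNorm_sum_le {σ ι : Type*} (s : Finset ι) (f : ι → MvPolynomial σ ℝ) :
    coeffNorm (∑ i ∈ s, f i) ≤ ∑ i ∈ s, coeffNorm (f i) :=
  Finset.le_sum_of_subadditive _ coeffNorm_zero.le coeffNorm_add_le _ _

lemma coeffNorm_monomial_mul_le {σ : Type*} (w : σ →₀ ℕ) (a : ℝ) (g : MvPolynomial σ ℝ) :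
    coeffNorm (MvPolynomial.monomial w a * g) ≤ |a| * coeffNorm g := by
  classical
  have h : MvPolynomial.monomial w a * g =
      ∑ v ∈ g.support, MvPolynomial.monomial (w + v) (a * g.coeff v) := by
    conv_lhs => rw [g.as_sum, Finset.mul_sum]
    simp [MvPolynomial.monomial_mul]
  rw [h]
  refine (coeffNorm_sum_le _ _).trans ?_
  rw [coeffNorm, Finset.mul_sum]
  refine Finset.sum_le_sum fun v _ => ?_
  rw [coeffNorm_eq_sum _ (MvPolynomial.support_monomial_subset), Finset.sum_singleton,
    MvPolynomial.coeff_monomial, if_pos rfl, abs_mul]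

lemma coeffNorm_mul_le {σ : Type*} (f g : MvPolynomial σ ℝ) :
    coeffNorm (f * g) ≤ coeffNorm f * coeffNorm g := by
  have h : f * g = ∑ v ∈ f.support, MvPolynomial.monomial v (f.coeff v) * g := by
    conv_lhs => rw [f.as_sum, Finset.sum_mul]
  rw [h, coeffNorm.eq_def f, Finset.sum_mul]
  exact (coeffNorm_sum_le _ _).trans (Finset.sum_le_sum fun v _ => coeffNorm_monomial_mul_le _ _ _)

lemma coeffNorm_one_le {σ : Type*} : coeffNorm (1 : MvPolynomial σ ℝ) ≤ 1 := by
  classical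
  rw [show (1 : MvPolynomial σ ℝ) = MvPolynomial.monomial 0 1 from rfl,
    coeffNorm_eq_sum _ (MvPolynomial.support_monomial_subset), Finset.sum_singleton,
    MvPolynomial.coeff_monomial, if_pos rfl, abs_one]

lemma coeffNorm_prod_le_one {σ ι : Type*} (s : Finset ι) (f : ι → MvPolynomial σ ℝ)
    (hf : ∀ i ∈ s, coeffNorm (f i) ≤ 1) : coeffNorm (∏ i ∈ s, f i) ≤ 1 := by
  classical
  induction s using Finset.induction_on with
  | empty => simpa using coeffNorm_one_le
  | insert i s hi ih =>
    rw [Finset.prod_insert hi]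
    exact (coeffNorm_mul_le _ _).trans (mul_le_one₀ (hf i (by simp)) (coeffNorm_nonneg _)
      (ih fun j hj => hf j (by simp [hj])))

/-- Hybrid argument: exchange one factor at a time, the remaining factors having norm at most one.
-/
lemma coeffNorm_prod_sub_prod_le {σ ι : Type*} (s : Finset ι) (f g : ι → MvPolynomial σ ℝ)
    (hf : ∀ i ∈ s, coeffNorm (f i) ≤ 1) (hg : ∀ i ∈ s, coeffNorm (g i) ≤ 1) :
    coeffNorm (∏ i ∈ s, f i - ∏ i ∈ s, g i) ≤ ∑ i ∈ s, coeffNorm (f i - g i) := by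
  classical
  induction s using Finset.induction_on with
  | empty => simp [coeffNorm_zero]
  | insert i s hi ih =>
    rw [Finset.prod_insert hi, Finset.prod_insert hi, Finset.sum_insert hi]
    have h : f i * ∏ j ∈ s, f j - g i * ∏ j ∈ s, g j =
        (f i - g i) * ∏ j ∈ s, f j + g i * (∏ j ∈ s, f j - ∏ j ∈ s, g j) := by ring
    rw [h]
    refine (coeffNorm_add_le _ _).trans (add_le_add ((coeffNorm_mul_le _ _).trans ?_)
      ((coeffNorm_mul_le _ _).trans ?_))
    · exact mul_le_of_le_one_right (coeffNorm_nonneg _)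
        (coeffNorm_prod_le_one _ _ fun j hj => hf j (by simp [hj]))
    · exact (mul_le_of_le_one_left (coeffNorm_nonneg _) (hg i (by simp))).trans
        (ih (fun j hj => hf j (by simp [hj])) fun j hj => hg j (by simp [hj]))

/-- The generating polynomial `∑ j, x j * X j` of a single categorical variable. -/
noncomputable def linForm {k : ℕ} (x : Fin k → ℝ) : MvPolynomial (Fin k) ℝ :=
  ∑ j, MvPolynomial.monomial (Finsupp.single j 1) (x j)

lemma coeffNorm_linForm_le {k : ℕ} {x : Fin k → ℝ} (hx : x ∈ stdSimplex ℝ (Fin k)) :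
    coeffNorm (linForm x) ≤ 1 := by
  refine (coeffNorm_sum_le _ _).trans ?_
  rw [← hx.2]
  refine Finset.sum_le_sum fun j _ => ?_
  rw [coeffNorm_eq_sum _ (MvPolynomial.support_monomial_subset), Finset.sum_singleton,
    MvPolynomial.coeff_monomial, if_pos rfl, abs_of_nonneg (hx.1 j)]

lemma isHomogeneous_prod_linForm {G : Type*} [Fintype G] {k : ℕ} (x : G → Fin k → ℝ) :
    (∏ i, linForm (x i)).IsHomogeneous (Fintype.card G) := by
  have := MvPolynomial.IsHomogeneous.prod Finset.univ (fun i => linForm (x i)) (fun _ => 1)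
    fun i _ => MvPolynomial.IsHomogeneous.sum _ _ _ fun j _ =>
      MvPolynomial.isHomogeneous_monomial _ (by simp)
  simpa using this

lemma coeff_mul_nonneg {σ : Type*} {f g : MvPolynomial σ ℝ} (hf : ∀ v, 0 ≤ f.coeff v)
    (hg : ∀ v, 0 ≤ g.coeff v) (v : σ →₀ ℕ) : 0 ≤ (f * g).coeff v := by
  classical
  rw [MvPolynomial.coeff_mul]
  exact Finset.sum_nonneg fun p _ => mul_nonneg (hf _) (hg _)

lemma coeff_prod_linForm_nonneg {ι : Type*} (s : Finset ι) {k : ℕ} (x : ι → Fin k → ℝ)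
    (hx : ∀ i, x i ∈ stdSimplex ℝ (Fin k)) (v : Fin k →₀ ℕ) :
    0 ≤ (∏ i ∈ s, linForm (x i)).coeff v := by
  classical
  induction s using Finset.induction_on generalizing v with
  | empty => rw [Finset.prod_empty, MvPolynomial.coeff_one]; split_ifs <;> simp
  | insert i s hi ih =>
    rw [Finset.prod_insert hi]
    refine coeff_mul_nonneg (fun w => ?_) ih v
    rw [linForm, MvPolynomial.coeff_sum]
    refine Finset.sum_nonneg fun j _ => ?_
    rw [MvPolynomial.coeff_monomial]
    split_ifs
    · exact (hx i).1 j
    · exact le_rfl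

lemma eval₂_linForm {R : Type*} [CommSemiring R] {k : ℕ} (φ : ℝ →+* R) (z : Fin k → R)
    (x : Fin k → ℝ) : (linForm x).eval₂ φ z = ∑ j, φ (x j) * z j := by
  simp [linForm, MvPolynomial.eval₂_sum, MvPolynomial.eval₂_monomial]

lemma eval₂_prod_linForm {ι R : Type*} [CommSemiring R] {k : ℕ} (s : Finset ι) (φ : ℝ →+* R)
    (z : Fin k → R) (x : ι → Fin k → ℝ) :
    (∏ i ∈ s, linForm (x i)).eval₂ φ z = ∏ i ∈ s, ∑ j, φ (x i j) * z j := by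
  rw [MvPolynomial.eval₂_prod]
  exact Finset.prod_congr rfl fun i _ => eval₂_linForm φ z (x i)

/-! ### Coefficient extraction by Fourier inversion on the torus. -/

/-- The point of the torus with phases `θ`, the coordinate `o` being normalised to `1`. -/
noncomputable def torusPoint {k : ℕ} (o : Fin k) (θ : Fin k → ℝ) (j : Fin k) : ℂ :=
  if j = o then 1 else Complex.exp (θ j * Complex.I)

/-- Lebesgue measure on the cube `(-π, π] ^ k`. -/
noncomputable def cubeMeasure (k : ℕ) : Measure (Fin k → ℝ) :=
  Measure.pi fun _ => volume.restrict (Set.Ioc (-Real.pi) Real.pi)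

lemma integral_exp_int_mul (n : ℤ) :
    ∫ t in Set.Ioc (-Real.pi) Real.pi, Complex.exp (n * (t * Complex.I)) =
      if n = 0 then (2 * Real.pi : ℂ) else 0 := by
  rw [← intervalIntegral.integral_of_le (by linarith [Real.pi_pos])]
  split_ifs with h
  · subst h
    simp
    ring
  · have hc : (n : ℂ) * Complex.I ≠ 0 := mul_ne_zero (Int.cast_ne_zero.2 h) Complex.I_ne_zero
    have h1 : ∀ t : ℝ, Complex.exp (n * (t * Complex.I)) = Complex.exp (n * Complex.I * t) :=
      fun t => by ring_nf
    simp_rw [h1]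
    rw [integral_exp_mul_complex hc, div_eq_zero_iff]
    left
    rw [sub_eq_zero, Complex.exp_eq_exp_iff_exists_int]
    exact ⟨n, by push_cast; ring⟩

/-- Nothing is lost by fixing the coordinate `o`: with the total degree prescribed, its exponent is
determined by the others. The idle phase `θ o` contributes a plain factor `2 π`. -/
lemma integral_cubeMeasure_torusPoint {k : ℕ} (o : Fin k) {N : ℕ} {w v : Fin k →₀ ℕ}
    (hw : w.degree = N) (hv : v.degree = N) :
    ∫ θ, (∏ j, torusPoint o θ j ^ w j) *
        ∏ j, (if j = o then 1 else Complex.exp (-(v j : ℤ) * (θ j * Complex.I))) ∂cubeMeasure k =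
      if w = v then (2 * Real.pi : ℂ) ^ k else 0 := by
  have h1 : ∀ θ : Fin k → ℝ, (∏ j, torusPoint o θ j ^ w j) *
        ∏ j, (if j = o then 1 else Complex.exp (-(v j : ℤ) * (θ j * Complex.I))) =
      ∏ j, Complex.exp ((if j = o then (0 : ℤ) else (w j : ℤ) - v j : ℤ) * (θ j * Complex.I)) := by
    intro θ
    rw [← Finset.prod_mul_distrib]
    refine Finset.prod_congr rfl fun j _ => ?_
    by_cases hj : j = o
    · simp [hj, torusPoint]
    · simp only [torusPoint, hj, if_false]
      rw [← Complex.exp_nat_mul, ← Complex.exp_add]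
      push_cast
      ring_nf
  simp_rw [h1]
  rw [cubeMeasure, integral_fintype_prod_eq_prod
    (fun j (t : ℝ) => Complex.exp ((if j = o then (0 : ℤ) else (w j : ℤ) - v j : ℤ) *
      (t * Complex.I)))]
  simp_rw [integral_exp_int_mul]
  split_ifs with h
  · subst h
    simp
  · obtain ⟨j, hjo, hj⟩ : ∃ j, j ≠ o ∧ w j ≠ v j := by
      by_contra! hcon
      refine h (Finsupp.ext fun j => ?_)
      by_cases hjo : j = o
      · subst hjo
        rw [Finsupp.degree_eq_sum, ← Finset.add_sum_erase _ _ (Finset.mem_univ j)] at hw hv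
        have : ∑ i ∈ Finset.univ.erase j, w i = ∑ i ∈ Finset.univ.erase j, v i :=
          Finset.sum_congr rfl fun i hi => hcon i (Finset.ne_of_mem_erase hi)
        omega
      · exact hcon j hjo
    refine Finset.prod_eq_zero (Finset.mem_univ j) ?_
    rw [if_neg]
    simp only [hjo, if_false]
    omega

lemma ae_cubeMeasure (k : ℕ) :
    ∀ᵐ θ ∂cubeMeasure k, ∀ j, |θ j| ≤ Real.pi := by
  rw [cubeMeasure, ← Measure.restrict_pi_pi]
  filter_upwards [ae_restrict_mem (MeasurableSet.univ_pi fun _ => measurableSet_Ioc)] with θ hθ j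
  have := hθ j (Set.mem_univ j)
  exact abs_le.2 ⟨this.1.le, this.2⟩

instance isFiniteMeasure_cubeMeasure (k : ℕ) : IsFiniteMeasure (cubeMeasure k) := by
  unfold cubeMeasure; infer_instance

lemma degree_eq_of_coeff_ne_zero {σ : Type*} {N : ℕ} {f : MvPolynomial σ ℝ}
    (hf : f.IsHomogeneous N) {v : σ →₀ ℕ} (hv : f.coeff v ≠ 0) : v.degree = N := by
  rw [Finsupp.degree_eq_weight_one]
  exact hf hv

/-- A pointwise bound by a product on the torus bounds all coefficients. -/
lemma abs_coeff_le_of_torus_bound {k N : ℕ} (o : Fin k) (f : MvPolynomial (Fin k) ℝ)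
    (hf : f.IsHomogeneous N) {τ : ℝ} (ψ : Fin k → ℝ → ℝ) (hψ : ∀ j, Continuous (ψ j))
    (hb : ∀ θ : Fin k → ℝ, (∀ j, |θ j| ≤ Real.pi) →
      ‖f.eval₂ (algebraMap ℝ ℂ) (torusPoint o θ)‖ ≤ τ * ∏ j, ψ j (θ j)) (v : Fin k →₀ ℕ)
    (hv : f.coeff v ≠ 0) :
    |f.coeff v| ≤ τ * ∏ j, ((2 * Real.pi)⁻¹ * ∫ t in Set.Ioc (-Real.pi) Real.pi, ψ j t) := by
  classical
  have hpi := Real.pi_pos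
  have hdv : v.degree = N := degree_eq_of_coeff_ne_zero hf hv
  set χ : (Fin k → ℝ) → ℂ := fun θ =>
    ∏ j, (if j = o then 1 else Complex.exp (-(v j : ℤ) * (θ j * Complex.I))) with hχ
  have hχn : ∀ θ, ‖χ θ‖ = 1 := by
    intro θ
    rw [hχ, norm_prod]
    refine Finset.prod_eq_one fun j _ => ?_
    split_ifs
    · simp
    · rw [show (-(v j : ℤ) * (θ j * Complex.I) : ℂ) = ((-(v j : ℝ) * θ j : ℝ) : ℂ) * Complex.I by
        push_cast; ring, Complex.norm_exp_ofReal_mul_I]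
  have hχc : Continuous χ := by
    refine continuous_finsetProd _ fun j _ => ?_
    split_ifs <;> fun_prop
  have hzc : ∀ j, Continuous fun θ : Fin k → ℝ => torusPoint o θ j := by
    intro j
    unfold torusPoint
    split_ifs <;> fun_prop
  have hbdd : ∀ g : (Fin k → ℝ) → ℂ, Continuous g → Integrable g (cubeMeasure k) := by
    intro g hg
    obtain ⟨C, hC⟩ := (isCompact_univ_pi fun _ : Fin k => isCompact_Icc
      (a := -Real.pi) (b := Real.pi)).exists_bound_of_continuousOn hg.continuousOn
    refine Integrable.of_bound hg.aestronglyMeasurable C ?_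
    filter_upwards [ae_cubeMeasure k] with θ hθ
    exact hC θ fun j _ => abs_le.1 (hθ j)
  have hint : ∫ θ, f.eval₂ (algebraMap ℝ ℂ) (torusPoint o θ) * χ θ ∂cubeMeasure k =
      ((f.coeff v : ℝ) : ℂ) * (2 * Real.pi : ℂ) ^ k := by
    have h1 : ∀ θ, f.eval₂ (algebraMap ℝ ℂ) (torusPoint o θ) * χ θ =
        ∑ w ∈ f.support, ((f.coeff w : ℝ) : ℂ) * ((∏ j, torusPoint o θ j ^ w j) * χ θ) := by
      intro θ
      rw [MvPolynomial.eval₂_eq', Finset.sum_mul]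
      exact Finset.sum_congr rfl fun w _ => by simp [mul_assoc]
    simp_rw [h1]
    rw [integral_finsetSum _ fun w _ => hbdd _ (by fun_prop)]
    have h2 : ∀ w ∈ f.support, ∫ θ, ((f.coeff w : ℝ) : ℂ) * ((∏ j, torusPoint o θ j ^ w j) * χ θ)
        ∂cubeMeasure k = if w = v then ((f.coeff w : ℝ) : ℂ) * (2 * Real.pi : ℂ) ^ k else 0 := by
      intro w hw
      have hdw : w.degree = N := 
        degree_eq_of_coeff_ne_zero hf (MvPolynomial.mem_support_iff.1 hw)
      rw [integral_const_mul, integral_cubeMeasure_torusPoint o hdw hdv]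
      split_ifs <;> simp
    rw [Finset.sum_congr rfl h2, Finset.sum_ite_eq' f.support v,
      if_pos (MvPolynomial.mem_support_iff.2 hv)]
  have hψi : Integrable (fun θ : Fin k → ℝ => τ * ∏ j, ψ j (θ j)) (cubeMeasure k) := by
    refine Integrable.const_mul ?_ _
    exact Integrable.fintype_prod fun j => (hψ j).integrableOn_Ioc
  have hle : ‖∫ θ, f.eval₂ (algebraMap ℝ ℂ) (torusPoint o θ) * χ θ ∂cubeMeasure k‖ ≤
      ∫ θ, τ * ∏ j, ψ j (θ j) ∂cubeMeasure k := by
    refine norm_integral_le_of_norm_le hψi ?_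
    filter_upwards [ae_cubeMeasure k] with θ hθ
    rw [norm_mul, hχn, mul_one]
    exact hb θ hθ
  rw [hint, integral_const_mul, cubeMeasure, integral_fintype_prod_eq_prod (fun j t => ψ j t)] at hle
  rw [Finset.prod_mul_distrib, Finset.prod_const, Finset.card_univ, Fintype.card_fin]
  have hn : ‖((f.coeff v : ℝ) : ℂ) * (2 * Real.pi : ℂ) ^ k‖ = |f.coeff v| * (2 * Real.pi) ^ k := by
    rw [norm_mul, norm_pow, Complex.norm_real, Real.norm_eq_abs]
    congr 2
    rw [norm_mul, Complex.norm_real, Real.norm_eq_abs, abs_of_pos hpi]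
    simp
  rw [hn] at hle
  rw [inv_pow, mul_left_comm, ← div_eq_inv_mul, le_div_iff₀ (by positivity)]
  exact hle

/-! ### Pointwise estimates on the torus. -/

lemma integral_Ioc_gaussian_le_sqrt {b : ℝ} (hb : 0 < b) :
    ∫ t in Set.Ioc (-Real.pi) Real.pi, Real.exp (-b * t ^ 2) ≤ √(Real.pi / b) := by
  rw [← integral_gaussian b]
  exact setIntegral_le_integral (integrable_exp_neg_mul_sq hb)
    (Filter.Eventually.of_forall fun t => (Real.exp_pos _).le)

lemma integral_Ioc_gaussian_le {b : ℝ} (hb : 0 ≤ b) :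
    ∫ t in Set.Ioc (-Real.pi) Real.pi, Real.exp (-b * t ^ 2) ≤ 2 * Real.pi := by
  have hpi := Real.pi_pos
  have h : ∫ t in Set.Ioc (-Real.pi) Real.pi, Real.exp (-b * t ^ 2) ≤
      ∫ t in Set.Ioc (-Real.pi) Real.pi, (1 : ℝ) := by
    refine integral_mono (Continuous.integrableOn_Ioc (by fun_prop))
      (Continuous.integrableOn_Ioc (by fun_prop)) fun t => ?_
    exact Real.exp_le_one_iff.2 (by nlinarith [sq_nonneg t])
  refine h.trans (le_of_eq ?_)
  simp [hpi.le]
  ring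

lemma sum_mul_torusPoint_eq {k : ℕ} {o : Fin k} {x : Fin k → ℝ}
    (hx : x ∈ stdSimplex ℝ (Fin k)) (θ : Fin k → ℝ) :
    ∑ j, (x j : ℂ) * torusPoint o θ j = 1 + ∑ j, (x j : ℂ) * (torusPoint o θ j - 1) := by
  have h : (∑ j, (x j : ℂ)) = 1 := by exact_mod_cast congrArg (fun t : ℝ => (t : ℂ)) hx.2
  simp_rw [mul_sub, mul_one, Finset.sum_sub_distrib, h]
  ring

lemma sum_erase_le_one {k : ℕ} (o : Fin k) {x : Fin k → ℝ} (hx : x ∈ stdSimplex ℝ (Fin k)) :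
    ∑ j ∈ Finset.univ.erase o, x j ≤ 1 := by
  rw [← hx.2]
  exact Finset.sum_le_sum_of_subset_of_nonneg (Finset.erase_subset _ _) fun j _ _ => hx.1 j

lemma norm_sum_mul_torusPoint_sub_one_le {k : ℕ} {o : Fin k} {x : Fin k → ℝ}
    (hx : x ∈ stdSimplex ℝ (Fin k)) (θ : Fin k → ℝ) :
    ‖∑ j, (x j : ℂ) * (torusPoint o θ j - 1)‖ ≤ ∑ j ∈ Finset.univ.erase o, x j * |θ j| := by
  rw [← Finset.add_sum_erase _ _ (Finset.mem_univ o)]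
  simp only [torusPoint, if_true, sub_self, mul_zero, zero_add]
  refine (norm_sum_le _ _).trans (Finset.sum_le_sum fun j hj => ?_)
  rw [if_neg (Finset.ne_of_mem_erase hj), norm_mul, Complex.norm_real,
    Real.norm_of_nonneg (hx.1 j), mul_comm (θ j : ℂ)]
  exact mul_le_mul_of_nonneg_left (Real.norm_exp_I_mul_ofReal_sub_one_le) (hx.1 j)

lemma sq_sum_mul_abs_le {k : ℕ} (o : Fin k) {x : Fin k → ℝ} (hx : x ∈ stdSimplex ℝ (Fin k))
    (θ : Fin k → ℝ) :
    (∑ j ∈ Finset.univ.erase o, x j * |θ j|) ^ 2 ≤ ∑ j ∈ Finset.univ.erase o, x j * θ j ^ 2 := by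
  have h := Finset.sum_sq_le_sum_mul_sum_of_sq_le_mul (Finset.univ.erase o)
    (r := fun j => x j * |θ j|) (f := x) (g := fun j => x j * θ j ^ 2)
    (fun j _ => hx.1 j) (fun j _ => mul_nonneg (hx.1 j) (sq_nonneg _))
    (fun j _ => by rw [mul_pow, sq_abs]; exact le_of_eq (by ring))
  refine h.trans (mul_le_of_le_one_left ?_ (sum_erase_le_one o hx))
  exact Finset.sum_nonneg fun j _ => mul_nonneg (hx.1 j) (sq_nonneg _)

/-- With `R = ∑ x j (1 - cos θ j)` over `j ≠ o`, the real part is `1 - R`. Cauchy–Schwarz bounds `R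
^ 2` plus the squared imaginary part by `(1 - x o) * 2 R`, so the squared modulus is at most `1 - 2
x o R`. Then `1 - cos t ≥ 2 t ^ 2 / π ^ 2 ≥ t ^ 2 / 5` on `[-π, π]`. -/
lemma norm_sum_mul_torusPoint_le {k : ℕ} {o : Fin k} {x : Fin k → ℝ}
    (hx : x ∈ stdSimplex ℝ (Fin k)) {b : ℝ} (hb : 0 ≤ b) (hbo : b ≤ x o) {θ : Fin k → ℝ}
    (hθ : ∀ j, |θ j| ≤ Real.pi) :
    ‖∑ j, (x j : ℂ) * torusPoint o θ j‖ ≤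
      Real.exp (-(b / 5 * ∑ j ∈ Finset.univ.erase o, x j * θ j ^ 2)) := by
  set s := Finset.univ.erase o with hs
  set R := ∑ j ∈ s, x j * (1 - Real.cos (θ j)) with hR
  have hxs : x o + ∑ j ∈ s, x j = 1 := by rw [hs, Finset.add_sum_erase _ _ (Finset.mem_univ o), hx.2]
  have hz : ∑ j, (x j : ℂ) * torusPoint o θ j =
      ((1 - R : ℝ) : ℂ) + ((∑ j ∈ s, x j * Real.sin (θ j) : ℝ) : ℂ) * Complex.I := by
    rw [← Finset.add_sum_erase _ _ (Finset.mem_univ o), ← hs, hR]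
    simp only [mul_sub, mul_one, Finset.sum_sub_distrib]
    have h1 : ∀ j ∈ s, (x j : ℂ) * torusPoint o θ j =
        ((x j * Real.cos (θ j) : ℝ) : ℂ) + ((x j * Real.sin (θ j) : ℝ) : ℂ) * Complex.I := by
      intro j hj
      rw [torusPoint, if_neg (Finset.ne_of_mem_erase hj), Complex.exp_mul_I]
      push_cast
      ring
    rw [Finset.sum_congr rfl h1, Finset.sum_add_distrib, ← Finset.sum_mul, torusPoint, if_pos rfl,
      eq_sub_of_add_eq hxs]
    push_cast
    ring
  have h1mx : ∑ j ∈ s, x j = 1 - x o := by linarith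
  have hxo := hx.1 o
  have hnn : ∀ j ∈ s, 0 ≤ x j := fun j _ => hx.1 j
  have hcs1 : R ^ 2 ≤ (1 - x o) * ∑ j ∈ s, x j * (1 - Real.cos (θ j)) ^ 2 := by
    rw [← h1mx]
    exact Finset.sum_sq_le_sum_mul_sum_of_sq_le_mul s hnn
      (fun j hj => mul_nonneg (hnn j hj) (sq_nonneg _)) (fun j _ => le_of_eq (by ring))
  have hcs2 : (∑ j ∈ s, x j * Real.sin (θ j)) ^ 2 ≤
      (1 - x o) * ∑ j ∈ s, x j * Real.sin (θ j) ^ 2 := by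
    rw [← h1mx]
    exact Finset.sum_sq_le_sum_mul_sum_of_sq_le_mul s hnn
      (fun j hj => mul_nonneg (hnn j hj) (sq_nonneg _)) (fun j _ => le_of_eq (by ring))
  have hsum : ∑ j ∈ s, x j * (1 - Real.cos (θ j)) ^ 2 + ∑ j ∈ s, x j * Real.sin (θ j) ^ 2 =
      2 * R := by
    rw [hR, Finset.mul_sum, ← Finset.sum_add_distrib]
    refine Finset.sum_congr rfl fun j _ => ?_
    rw [Real.sin_sq]; ring
  have hRnn : 0 ≤ R := Finset.sum_nonneg fun j hj => mul_nonneg (hnn j hj)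
    (by linarith [Real.cos_le_one (θ j)])
  have hRlow : 1 / 5 * ∑ j ∈ s, x j * θ j ^ 2 ≤ R := by
    rw [Finset.mul_sum]
    refine Finset.sum_le_sum fun j hj => ?_
    have hc := Real.cos_le_one_sub_mul_cos_sq (hθ j)
    have hpi : Real.pi ^ 2 ≤ 10 := by nlinarith [Real.pi_lt_d2, Real.pi_pos]
    have h5 : 1 / 5 ≤ 2 / Real.pi ^ 2 := by
      rw [div_le_div_iff₀ (by norm_num) (by positivity)]; linarith
    have := mul_le_mul_of_nonneg_right h5 (sq_nonneg (θ j))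
    have := mul_le_mul_of_nonneg_left (show 1 / 5 * θ j ^ 2 ≤ 1 - Real.cos (θ j) by linarith)
      (hnn j hj)
    linarith
  have hsq : ‖∑ j, (x j : ℂ) * torusPoint o θ j‖ ^ 2 ≤ 1 - 2 * x o * R := by
    rw [hz, ← Complex.normSq_eq_norm_sq, Complex.normSq_add_mul_I]
    nlinarith
  have hfin : ‖∑ j, (x j : ℂ) * torusPoint o θ j‖ ^ 2 ≤
      Real.exp (-(b / 5 * ∑ j ∈ s, x j * θ j ^ 2)) ^ 2 := by
    rw [← Real.exp_nat_mul]
    refine hsq.trans ?_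
    refine le_trans ?_ (Real.add_one_le_exp _)
    have h1 := mul_le_mul hbo hRlow (by
      refine mul_nonneg (by norm_num) (Finset.sum_nonneg fun j hj =>
        mul_nonneg (hnn j hj) (sq_nonneg _))) hxo
    push_cast
    linarith
  exact (pow_le_pow_iff_left₀ (norm_nonneg _) (Real.exp_pos _).le two_ne_zero).1 hfin

/-- The set where `‖exp z‖ ≤ E` is a half-plane, hence convex, and the mean value inequality applies
on it. -/
lemma norm_exp_sub_exp_le {a b : ℂ} {E : ℝ} (ha : ‖Complex.exp a‖ ≤ E) (hb : ‖Complex.exp b‖ ≤ E) :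
    ‖Complex.exp a - Complex.exp b‖ ≤ E * ‖a - b‖ := by
  have hE : 0 < E := (norm_pos_iff.2 (Complex.exp_ne_zero a)).trans_le ha
  have hmem : ∀ z : ℂ, ‖Complex.exp z‖ ≤ E ↔ z.re ≤ Real.log E := fun z => by
    rw [Complex.norm_exp, Real.le_log_iff_exp_le hE]
  refine Convex.norm_image_sub_le_of_norm_hasDerivWithin_le (f := Complex.exp) (f' := Complex.exp)
    (s := {z : ℂ | z.re ≤ Real.log E}) (fun z _ => (Complex.hasDerivAt_exp z).hasDerivWithinAt)
    (fun z hz => (hmem z).2 hz) (convex_halfSpace_re_le _) ((hmem b).1 hb) ((hmem a).1 ha)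

/-- Two powers of `‖u‖` are kept instead of being bounded by `ρ`: their sum over rows is later
absorbed by Gaussian decay, so the number of rows never enters. -/
lemma norm_log_sub_logTaylor_le_sq_mul {m : ℕ} (hm : 1 ≤ m) {ρ : ℝ} (hρ : ρ ≤ 1 / 2) {u : ℂ}
    (hu : ‖u‖ ≤ ρ) :
    ‖Complex.log (1 + u) - Complex.logTaylor (m + 1) u‖ ≤ ρ ^ (m - 1) * ‖u‖ ^ 2 := by
  have h0 := norm_nonneg u
  refine (Complex.norm_log_sub_logTaylor_le m (by linarith)).trans ?_
  have h1 : ‖u‖ ^ (m + 1) ≤ ρ ^ (m - 1) * ‖u‖ ^ 2 := by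
    rw [show m + 1 = (m - 1) + 2 by omega, pow_add]
    exact mul_le_mul_of_nonneg_right (pow_le_pow_left₀ h0 hu _) (sq_nonneg _)
  have h2 : (1 - ‖u‖)⁻¹ ≤ 2 := by
    rw [inv_le_comm₀ (by linarith) (by norm_num)]; linarith
  have hm' : (1 : ℝ) ≤ m := by exact_mod_cast hm
  rw [div_le_iff₀ (by positivity)]
  calc ‖u‖ ^ (m + 1) * (1 - ‖u‖)⁻¹ ≤ (ρ ^ (m - 1) * ‖u‖ ^ 2) * 2 :=
        mul_le_mul h1 h2 (inv_nonneg.2 (by linarith))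
          (mul_nonneg (pow_nonneg (h0.trans hu) _) (sq_nonneg _))
    _ ≤ _ := mul_le_mul_of_nonneg_left (by linarith)
          (mul_nonneg (pow_nonneg (h0.trans hu) _) (sq_nonneg _))

/-- Two products `∏ (1 + u i)` of factors close to one whose low power sums agree are close. -/
lemma norm_prod_one_add_sub_le {G : Type*} [Fintype G] {m : ℕ} (hm : 1 ≤ m) {ρ E : ℝ}
    (hρ : ρ ≤ 1 / 2) (u v : G → ℂ) (hu : ∀ i, ‖u i‖ ≤ ρ) (hv : ∀ i, ‖v i‖ ≤ ρ)
    (hpow : ∀ r ≤ m, ∑ i, u i ^ r = ∑ i, v i ^ r)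
    (hE : ‖∏ i, (1 + u i)‖ ≤ E) (hE' : ‖∏ i, (1 + v i)‖ ≤ E) :
    ‖∏ i, (1 + u i) - ∏ i, (1 + v i)‖ ≤
      E * (ρ ^ (m - 1) * (∑ i, ‖u i‖ ^ 2 + ∑ i, ‖v i‖ ^ 2)) := by
  have hexp : ∀ w : G → ℂ, (∀ i, ‖w i‖ ≤ ρ) →
      ∏ i, (1 + w i) = Complex.exp (∑ i, Complex.log (1 + w i)) := by
    intro w hw
    rw [Complex.exp_sum]
    refine Finset.prod_congr rfl fun i _ => (Complex.exp_log fun h => ?_).symm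
    have : w i = -1 := by linear_combination h
    have := hw i
    simp_all
    linarith
  have hT : ∑ i, Complex.logTaylor (m + 1) (u i) = ∑ i, Complex.logTaylor (m + 1) (v i) := by
    simp only [Complex.logTaylor]
    rw [Finset.sum_comm, Finset.sum_comm (s := Finset.univ)]
    refine Finset.sum_congr rfl fun r hr => ?_
    have := hpow r (by simpa [Nat.lt_succ_iff] using hr)
    simp_rw [mul_div_assoc, ← Finset.mul_sum, ← Finset.sum_div, this]
  rw [hexp u hu, hexp v hv]
  rw [hexp u hu] at hE
  rw [hexp v hv] at hE'
  refine (norm_exp_sub_exp_le hE hE').trans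
    (mul_le_mul_of_nonneg_left ?_ ((norm_nonneg _).trans hE))
  have hsplit : ∑ i, Complex.log (1 + u i) - ∑ i, Complex.log (1 + v i) =
      ∑ i, (Complex.log (1 + u i) - Complex.logTaylor (m + 1) (u i)) -
      ∑ i, (Complex.log (1 + v i) - Complex.logTaylor (m + 1) (v i)) := by
    rw [Finset.sum_sub_distrib, Finset.sum_sub_distrib, hT]; ring
  rw [hsplit, mul_add, Finset.mul_sum, Finset.mul_sum]
  refine (norm_sub_le _ _).trans (add_le_add ?_ ?_)
  · exact (norm_sum_le _ _).trans (Finset.sum_le_sum fun i _ =>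
      norm_log_sub_logTaylor_le_sq_mul hm hρ (hu i))
  · exact (norm_sum_le _ _).trans (Finset.sum_le_sum fun i _ =>
      norm_log_sub_logTaylor_le_sq_mul hm hρ (hv i))

lemma sum_pow_sum_eq_of_wordMoment {G : Type*} [Fintype G] {k r : ℕ} (x q : G → Fin k → ℝ)
    (h : ∀ f : Fin r → Fin k, ∑ i, ∏ t, q i (f t) = ∑ i, ∏ t, x i (f t)) (c : Fin k → ℂ) :
    ∑ i, (∑ j, (x i j : ℂ) * c j) ^ r = ∑ i, (∑ j, (q i j : ℂ) * c j) ^ r := by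
  have hexp : ∀ y : G → Fin k → ℝ, ∑ i, (∑ j, (y i j : ℂ) * c j) ^ r =
      ∑ f : Fin r → Fin k, ((∑ i, ∏ t, y i (f t) : ℝ) : ℂ) * ∏ t, c (f t) := by
    intro y
    simp_rw [Fintype.sum_pow, Finset.prod_mul_distrib]
    rw [Finset.sum_comm]
    refine Finset.sum_congr rfl fun f _ => ?_
    rw [← Finset.sum_mul]
    push_cast
    rfl
  rw [hexp, hexp]
  exact Finset.sum_congr rfl fun f _ => by rw [h f]

/-- Column sums away from the reference coordinate `o`. -/
noncomputable def columnSum {G : Type*} [Fintype G] {k : ℕ} (o : Fin k) (x : G → Fin k → ℝ)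
    (j : Fin k) : ℝ := if j = o then 0 else ∑ i, x i j

lemma sum_columnSum_mul {G : Type*} [Fintype G] {k : ℕ} (o : Fin k) (x : G → Fin k → ℝ)
    (c : Fin k → ℝ) :
    ∑ j, columnSum o x j * c j = ∑ i, ∑ j ∈ Finset.univ.erase o, x i j * c j := by
  rw [Finset.sum_comm, ← Finset.add_sum_erase _ _ (Finset.mem_univ o)]
  simp only [columnSum, if_true, zero_mul, zero_add]
  refine Finset.sum_congr rfl fun j hj => ?_
  rw [if_neg (Finset.ne_of_mem_erase hj), Finset.sum_mul]

lemma columnSum_nonneg {G : Type*} [Fintype G] {k : ℕ} (o : Fin k) {x : G → Fin k → ℝ}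
    (hx : ∀ i, x i ∈ stdSimplex ℝ (Fin k)) (j : Fin k) : 0 ≤ columnSum o x j := by
  unfold columnSum
  split_ifs
  · exact le_rfl
  · exact Finset.sum_nonneg fun i _ => (hx i).1 j

lemma norm_eval₂_prod_linForm_le {G : Type*} [Fintype G] {k : ℕ} {o : Fin k}
    {x : G → Fin k → ℝ} (hx : ∀ i, x i ∈ stdSimplex ℝ (Fin k)) {b : ℝ} (hb : 0 ≤ b)
    (hbo : ∀ i, b ≤ x i o) {θ : Fin k → ℝ} (hθ : ∀ j, |θ j| ≤ Real.pi) :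
    ‖(∏ i, linForm (x i)).eval₂ (algebraMap ℝ ℂ) (torusPoint o θ)‖ ≤
      Real.exp (-(b / 5 * ∑ j, columnSum o x j * θ j ^ 2)) := by
  rw [eval₂_prod_linForm, norm_prod, sum_columnSum_mul, Finset.mul_sum, ← Finset.sum_neg_distrib,
    Real.exp_sum]
  exact Finset.prod_le_prod (fun i _ => norm_nonneg _) fun i _ =>
    norm_sum_mul_torusPoint_le (hx i) hb (hbo i) hθ

/-- Each product is at most `exp (-(b / 5) Θ)`; one half of this exponent is kept for the later
integration and the other half is spent here. If the phases of all heavy columns are at most `r`,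
every factor is within `ρ` of one and moment matching leaves an error `ρ ^ (m - 1) * 2 Θ`, whose `Θ`
the spent half absorbs. Otherwise `Θ ≥ B r ^ 2`, and the spent half makes both products small. -/
lemma norm_eval₂_sub_le {G : Type*} [Fintype G] {k m : ℕ} (hm : 1 ≤ m) {o : Fin k}
    {x q : G → Fin k → ℝ} (hx : ∀ i, x i ∈ stdSimplex ℝ (Fin k))
    (hq : ∀ i, q i ∈ stdSimplex ℝ (Fin k)) {b B δ r ρ : ℝ} (hb : 0 < b)
    (hxo : ∀ i, b ≤ x i o) (hqo : ∀ i, b ≤ q i o)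
    (hmom : ∀ r ≤ m, ∀ f : Fin r → Fin k, ∑ i, ∏ t, q i (f t) = ∑ i, ∏ t, x i (f t))
    (hB : 0 ≤ B) (hr : 0 ≤ r) (hδ : 0 ≤ δ) (hρ : r + 4 * k * δ ≤ ρ) (hρ' : ρ ≤ 1 / 2)
    (hcol : ∀ j, j ≠ o → B ≤ ∑ i, x i j ∨ ∀ i, x i j ≤ δ ∧ q i j ≤ δ)
    {θ : Fin k → ℝ} (hθ : ∀ j, |θ j| ≤ Real.pi) :
    ‖(∏ i, linForm (x i) - ∏ i, linForm (q i)).eval₂ (algebraMap ℝ ℂ) (torusPoint o θ)‖ ≤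
      (20 / b * ρ ^ (m - 1) + 2 * Real.exp (-(b / 10 * (B * r ^ 2)))) *
        ∏ j, Real.exp (-(b / 10 * columnSum o x j) * θ j ^ 2) := by
  have hcs : columnSum o q = columnSum o x := by
    ext j
    unfold columnSum
    split_ifs
    · rfl
    · simpa using hmom 1 hm fun _ => j
  set Θ := ∑ j, columnSum o x j * θ j ^ 2 with hΘ
  have hΘ0 : 0 ≤ Θ := Finset.sum_nonneg fun j _ => mul_nonneg (columnSum_nonneg o hx j) (sq_nonneg _)
  have hprod : ∏ j, Real.exp (-(b / 10 * columnSum o x j) * θ j ^ 2) =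
      Real.exp (-(b / 10 * Θ)) := by
    rw [← Real.exp_sum, hΘ, Finset.mul_sum, ← Finset.sum_neg_distrib]
    congr 1
    exact Finset.sum_congr rfl fun j _ => by ring
  have hFx := norm_eval₂_prod_linForm_le hx hb.le hxo hθ
  have hFq := norm_eval₂_prod_linForm_le hq hb.le hqo hθ
  rw [hcs] at hFq
  rw [← hΘ] at hFx hFq
  have hsplit : Real.exp (-(b / 5 * Θ)) =
      Real.exp (-(b / 10 * Θ)) * Real.exp (-(b / 10 * Θ)) := by
    rw [← Real.exp_add]; congr 1; ring
  have hρ0 : 0 ≤ ρ := le_trans (by positivity) hρ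
  rw [hprod, MvPolynomial.eval₂_sub, add_mul]
  by_cases hnear : ∀ j, j ≠ o → B ≤ ∑ i, x i j → |θ j| ≤ r
  · have hbound : ∀ y : G → Fin k → ℝ, (∀ i, y i ∈ stdSimplex ℝ (Fin k)) →
        (∀ j, j ≠ o → B ≤ ∑ i, x i j ∨ ∀ i, y i j ≤ δ) → ∀ i,
        ‖∑ j, (y i j : ℂ) * (torusPoint o θ j - 1)‖ ≤ ρ := by
      intro y hy hyc i
      refine (norm_sum_mul_torusPoint_sub_one_le (hy i) θ).trans (le_trans ?_ hρ)
      -- The phase in a small column is unrestricted: `|θ j| ≤ π ≤ 4`, and smallness comes from the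
      -- entry itself.
      have h1 : ∀ j ∈ Finset.univ.erase o, y i j * |θ j| ≤ y i j * r + 4 * δ := by
        intro j hj
        have hyj := (hy i).1 j
        rcases hyc j (Finset.ne_of_mem_erase hj) with h | h
        · have := mul_le_mul_of_nonneg_left (hnear j (Finset.ne_of_mem_erase hj) h) hyj
          linarith
        · have := mul_le_mul (h i) (hθ j) (abs_nonneg _) hδ
          have h3 : δ * Real.pi ≤ δ * 4 := mul_le_mul_of_nonneg_left Real.pi_le_four hδ
          have := mul_nonneg hyj hr
          linarith
      refine (Finset.sum_le_sum h1).trans ?_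
      rw [Finset.sum_add_distrib, ← Finset.sum_mul, Finset.sum_const, nsmul_eq_mul]
      have h2 := mul_le_of_le_one_left hr (sum_erase_le_one o (hy i))
      have h3 : ((Finset.univ.erase o).card : ℝ) ≤ k := by
        exact_mod_cast (Finset.card_le_univ _).trans (by simp)
      have h4 := mul_le_mul_of_nonneg_right h3 (show 0 ≤ 4 * δ by linarith)
      linarith
    have hsq : ∀ y : G → Fin k → ℝ, (∀ i, y i ∈ stdSimplex ℝ (Fin k)) → columnSum o y = columnSum o x →
        ∑ i, ‖∑ j, (y i j : ℂ) * (torusPoint o θ j - 1)‖ ^ 2 ≤ Θ := by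
      intro y hy hyc
      rw [hΘ, ← hyc, sum_columnSum_mul]
      exact Finset.sum_le_sum fun i _ => (pow_le_pow_left₀ (norm_nonneg _)
        (norm_sum_mul_torusPoint_sub_one_le (hy i) θ) 2).trans (sq_sum_mul_abs_le o (hy i) θ)
    have hev : ∀ y : G → Fin k → ℝ, (∀ i, y i ∈ stdSimplex ℝ (Fin k)) →
        (∏ i, linForm (y i)).eval₂ (algebraMap ℝ ℂ) (torusPoint o θ) =
          ∏ i, (1 + ∑ j, (y i j : ℂ) * (torusPoint o θ j - 1)) := by
      intro y hy
      rw [eval₂_prod_linForm]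
      exact Finset.prod_congr rfl fun i _ => sum_mul_torusPoint_eq (hy i) θ
    rw [hev x hx] at hFx ⊢
    rw [hev q hq] at hFq ⊢
    have h := norm_prod_one_add_sub_le hm hρ' _ _
      (hbound x hx fun j hj => (hcol j hj).imp_right fun h i => (h i).1)
      (hbound q hq fun j hj => (hcol j hj).imp_right fun h i => (h i).2)
      (fun r hr => sum_pow_sum_eq_of_wordMoment x q (hmom r hr) _) hFx hFq
    refine h.trans (le_trans ?_ (le_add_of_nonneg_right (by positivity)))
    have h2 : ρ ^ (m - 1) * (∑ i, ‖∑ j, (x i j : ℂ) * (torusPoint o θ j - 1)‖ ^ 2 +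
        ∑ i, ‖∑ j, (q i j : ℂ) * (torusPoint o θ j - 1)‖ ^ 2) ≤ ρ ^ (m - 1) * (2 * Θ) :=
      mul_le_mul_of_nonneg_left (by linarith [hsq x hx rfl, hsq q hq hcs]) (pow_nonneg hρ0 _)
    refine (mul_le_mul_of_nonneg_left h2 (Real.exp_pos _).le).trans ?_
    have h3 : b / 10 * Θ * Real.exp (-(b / 10 * Θ)) ≤ 1 := by
      rw [Real.exp_neg, ← div_eq_mul_inv, div_le_one (Real.exp_pos _)]
      linarith [Real.add_one_le_exp (b / 10 * Θ)]
    have h4 : Θ * Real.exp (-(b / 10 * Θ)) ≤ 10 / b := by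
      rw [le_div_iff₀ hb]; linarith
    rw [hsplit]
    have h5 := mul_le_mul_of_nonneg_left h4
      (show 0 ≤ 2 * ρ ^ (m - 1) * Real.exp (-(b / 10 * Θ)) by positivity)
    calc _ = 2 * ρ ^ (m - 1) * Real.exp (-(b / 10 * Θ)) * (Θ * Real.exp (-(b / 10 * Θ))) := by ring
      _ ≤ _ := h5
      _ = _ := by ring
  · push Not at hnear
    obtain ⟨j, hjo, hBj, hj⟩ := hnear
    have hfar : B * r ^ 2 ≤ Θ := by
      have h1 : columnSum o x j * θ j ^ 2 ≤ Θ := Finset.single_le_sum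
        (f := fun j => columnSum o x j * θ j ^ 2)
        (fun j _ => mul_nonneg (columnSum_nonneg o hx j) (sq_nonneg _)) (Finset.mem_univ j)
      refine le_trans ?_ h1
      rw [columnSum, if_neg hjo, ← sq_abs (θ j)]
      exact mul_le_mul hBj (pow_le_pow_left₀ hr hj.le 2) (sq_nonneg _) (hB.trans hBj)
    refine (norm_sub_le _ _).trans ((add_le_add hFx hFq).trans ?_)
    refine le_trans ?_ (le_add_of_nonneg_left (by positivity))
    rw [hsplit, ← two_mul, ← mul_assoc]
    refine mul_le_mul_of_nonneg_right (mul_le_mul_of_nonneg_left (Real.exp_le_exp.2 ?_)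
      zero_le_two) (Real.exp_pos _).le
    have := mul_le_mul_of_nonneg_left hfar (show 0 ≤ b / 10 by linarith)
    linarith

/-! ### Chernoff tails, lattice boxes, and the resulting coefficient norm bound. -/

lemma sum_coeff_mul_exp_le {G : Type*} [Fintype G] {k : ℕ} {x : G → Fin k → ℝ}
    (hx : ∀ i, x i ∈ stdSimplex ℝ (Fin k)) (j : Fin k) {l : ℝ} (hl : |l| ≤ 1) :
    ∑ v ∈ (∏ i, linForm (x i)).support,
        (∏ i, linForm (x i)).coeff v * Real.exp (l * (v j - ∑ i, x i j)) ≤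
      Real.exp ((∑ i, x i j) * l ^ 2) := by
  set s := ∑ i, x i j with hs
  set z : Fin k → ℝ := fun a => if a = j then Real.exp l else 1 with hz
  have hev : (∏ i, linForm (x i)).eval₂ (RingHom.id ℝ) z =
      ∑ v ∈ (∏ i, linForm (x i)).support, (∏ i, linForm (x i)).coeff v * Real.exp (l * v j) := by
    rw [MvPolynomial.eval₂_eq']
    refine Finset.sum_congr rfl fun v _ => ?_
    rw [Finset.prod_eq_single j (fun a _ ha => by simp [hz, ha]) (by simp)]
    simp [hz, ← Real.exp_nat_mul, mul_comm]
  have hle : (∏ i, linForm (x i)).eval₂ (RingHom.id ℝ) z ≤ Real.exp (s * (Real.exp l - 1)) := by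
    rw [eval₂_prod_linForm, hs, Finset.sum_mul, Real.exp_sum]
    refine Finset.prod_le_prod (fun i _ => Finset.sum_nonneg fun a _ => ?_) fun i _ => ?_
    · refine mul_nonneg ((hx i).1 a) ?_
      simp only [hz]
      split_ifs
      · exact (Real.exp_pos _).le
      · exact zero_le_one
    · have h1 : ∑ a, RingHom.id ℝ (x i a) * z a = 1 + x i j * (Real.exp l - 1) := by
        have h2 : ∀ a, RingHom.id ℝ (x i a) * z a =
            x i a + if a = j then x i j * (Real.exp l - 1) else 0 := by
          intro a
          by_cases ha : a = j
          · subst ha; simp [hz]; ring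
          · simp [hz, ha]
        simp_rw [h2]
        rw [Finset.sum_add_distrib, (hx i).2]
        simp
      rw [h1, add_comm]
      exact Real.add_one_le_exp _
  have hs0 : 0 ≤ s := Finset.sum_nonneg fun i _ => (hx i).1 j
  have hq : Real.exp l - 1 - l ≤ l ^ 2 := (le_abs_self _).trans (Real.abs_exp_sub_one_sub_id_le hl)
  calc _ = Real.exp (-(l * s)) * (∏ i, linForm (x i)).eval₂ (RingHom.id ℝ) z := by
        rw [hev, Finset.mul_sum]
        refine Finset.sum_congr rfl fun v _ => ?_
        rw [mul_left_comm, ← Real.exp_add]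
        ring_nf
    _ ≤ Real.exp (-(l * s)) * Real.exp (s * (Real.exp l - 1)) :=
        mul_le_mul_of_nonneg_left hle (Real.exp_pos _).le
    _ = Real.exp (s * (Real.exp l - 1 - l)) := by rw [← Real.exp_add]; ring_nf
    _ ≤ _ := Real.exp_le_exp.2 (mul_le_mul_of_nonneg_left hq hs0)

lemma sum_coeff_tail_le {G : Type*} [Fintype G] {k : ℕ} {x : G → Fin k → ℝ}
    (hx : ∀ i, x i ∈ stdSimplex ℝ (Fin k)) (j : Fin k) {l t T : ℝ} (hl0 : 0 ≤ l) (hl : l ≤ 1)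
    (hT : (∑ i, x i j) * l ^ 2 - l * t ≤ -T) (S : Finset (Fin k →₀ ℕ)) :
    ∑ v ∈ S.filter (fun v => t < |(v j : ℝ) - ∑ i, x i j|), (∏ i, linForm (x i)).coeff v ≤
      2 * Real.exp (-T) := by
  set F := ∏ i, linForm (x i) with hF
  set s := ∑ i, x i j with hs
  have hnn : ∀ v, 0 ≤ F.coeff v := fun v => coeff_prod_linForm_nonneg _ x hx v
  have h1 := sum_coeff_mul_exp_le hx j (l := l) (by rwa [abs_of_nonneg hl0])
  have h2 := sum_coeff_mul_exp_le hx j (l := -l) (by rwa [abs_neg, abs_of_nonneg hl0])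
  rw [neg_sq] at h2
  have hdrop : ∑ v ∈ S.filter (fun v => t < |(v j : ℝ) - s|), F.coeff v =
      ∑ v ∈ (S.filter (fun v => t < |(v j : ℝ) - s|)).filter (fun v => v ∈ F.support),
        F.coeff v := by
    exact (Finset.sum_filter_of_ne fun v _ hv => MvPolynomial.mem_support_iff.2 hv).symm
  have hterm : ∀ v : Fin k →₀ ℕ, t < |(v j : ℝ) - s| →
      F.coeff v ≤ Real.exp (-(l * t)) * (F.coeff v * Real.exp (l * (v j - s)) +
        F.coeff v * Real.exp (-l * (v j - s))) := by
    intro v hv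
    rw [← mul_add, mul_left_comm]
    refine le_mul_of_one_le_right (hnn v) ?_
    rw [mul_add, ← Real.exp_add, ← Real.exp_add]
    rcases lt_abs.1 hv with h | h
    · refine le_add_of_le_of_nonneg (Real.one_le_exp ?_) (Real.exp_pos _).le
      have := mul_le_mul_of_nonneg_left h.le hl0
      linarith
    · refine le_add_of_nonneg_of_le (Real.exp_pos _).le (Real.one_le_exp ?_)
      have := mul_le_mul_of_nonneg_left h.le hl0
      linarith
  calc _ ≤ ∑ v ∈ (S.filter (fun v => t < |(v j : ℝ) - s|)).filter (fun v => v ∈ F.support),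
        Real.exp (-(l * t)) * (F.coeff v * Real.exp (l * (v j - s)) +
        F.coeff v * Real.exp (-l * (v j - s))) := by
        rw [hdrop]
        exact Finset.sum_le_sum fun v hv =>
          hterm v (Finset.mem_filter.1 (Finset.mem_filter.1 hv).1).2
    _ ≤ ∑ v ∈ F.support, Real.exp (-(l * t)) * (F.coeff v * Real.exp (l * (v j - s)) +
        F.coeff v * Real.exp (-l * (v j - s))) := by
        refine Finset.sum_le_sum_of_subset_of_nonneg
          (fun v hv => (Finset.mem_filter.1 hv).2) fun v _ _ => ?_
        have := hnn v
        positivity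
    _ ≤ Real.exp (-(l * t)) * (Real.exp (s * l ^ 2) + Real.exp (s * l ^ 2)) := by
        rw [← Finset.mul_sum, Finset.sum_add_distrib]
        exact mul_le_mul_of_nonneg_left (add_le_add h1 h2) (Real.exp_pos _).le
    _ = 2 * Real.exp (s * l ^ 2 - l * t) := by
        rw [← two_mul, mul_left_comm, ← Real.exp_add]; ring_nf
    _ ≤ _ := mul_le_mul_of_nonneg_left (Real.exp_le_exp.2 hT) zero_le_two

lemma sum_biUnion_le_sum {ι α : Type*} [DecidableEq α] (s : Finset ι) (A : ι → Finset α)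
    {f : α → ℝ} (hf : ∀ v, 0 ≤ f v) : ∑ v ∈ s.biUnion A, f v ≤ ∑ j ∈ s, ∑ v ∈ A j, f v := by
  classical
  induction s using Finset.induction_on with
  | empty => simp
  | insert i s hi ih =>
    rw [Finset.biUnion_insert, Finset.sum_insert hi]
    have := Finset.sum_union_inter (s₁ := A i) (s₂ := s.biUnion A) (f := f)
    have := Finset.sum_nonneg fun v (_ : v ∈ A i ∩ s.biUnion A) => hf v
    linarith

/-- The Gaussian regime takes `l = √(4 L / s)`; when the mean `s` is below `4 L` this would exceed
one, and `l = 1` suffices. -/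
lemma exists_chernoff_parameter {s L : ℝ} (hL : 0 < L) :
    ∃ l : ℝ, 0 ≤ l ∧ l ≤ 1 ∧ s * l ^ 2 - l * (4 * √(L * s) + 8 * L) ≤ -(4 * L) := by
  by_cases h : 4 * L ≤ s
  · have hs' : 0 < s := by linarith
    refine ⟨√(4 * L / s), Real.sqrt_nonneg _, ?_, ?_⟩
    · exact Real.sqrt_le_one.2 ((div_le_one hs').2 h)
    · rw [Real.sq_sqrt (by positivity)]
      have h1 : √(4 * L / s) * √(L * s) = 2 * L := by
        rw [← Real.sqrt_mul (by positivity), show 4 * L / s * (L * s) = (2 * L) ^ 2 by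
          field_simp; ring, Real.sqrt_sq (by positivity)]
      have h2 : s * (4 * L / s) = 4 * L := by field_simp
      have h3 : 0 ≤ √(4 * L / s) * (8 * L) := by positivity
      nlinarith
  · refine ⟨1, zero_le_one, le_rfl, ?_⟩
    have := Real.sqrt_nonneg (L * s)
    linarith

lemma card_natIcc_le {s t : ℝ} (ht : 0 ≤ t) :
    ((Finset.Icc ⌈s - t⌉₊ ⌊s + t⌋₊).card : ℝ) ≤ 2 * t + 1 := by
  rw [Nat.card_Icc]
  rcases le_or_gt ⌈s - t⌉₊ (⌊s + t⌋₊ + 1) with h | h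
  · rw [Nat.cast_sub h]
    push_cast
    have h1 := Nat.le_ceil (s - t)
    rcases le_or_gt 0 (s + t) with h2 | h2
    · have := Nat.floor_le h2
      linarith
    · rw [Nat.floor_of_nonpos h2.le]
      simp only [Nat.cast_zero, zero_add]
      have : (0 : ℝ) ≤ (⌈s - t⌉₊ : ℝ) := Nat.cast_nonneg _
      linarith
  · rw [Nat.sub_eq_zero_of_le h.le]
    simp
    linarith

lemma card_box_le {k N : ℕ} (o : Fin k) (s t : Fin k → ℝ) (ht : ∀ j, 0 ≤ t j)
    (S : Finset (Fin k →₀ ℕ)) (hS : ∀ v ∈ S, v.degree = N)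
    (hbox : ∀ v ∈ S, ∀ j, j ≠ o → |(v j : ℝ) - s j| ≤ t j) :
    (S.card : ℝ) ≤ ∏ j, (2 * t j + 1) := by
  classical
  set A : Fin k → Finset ℕ := fun j => if j = o then {0} else Finset.Icc ⌈s j - t j⌉₊ ⌊s j + t j⌋₊
  have h1 : S.card ≤ (Fintype.piFinset A).card := by
    refine Finset.card_le_card_of_injOn (fun v j => if j = o then 0 else v j) ?_ ?_
    · intro v hv
      refine Fintype.mem_piFinset.2 fun j => ?_
      by_cases hj : j = o
      · simp [A, hj]
      · have := abs_le.1 (hbox v hv j hj)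
        simp only [A, hj, if_false, Finset.mem_Icc]
        exact ⟨Nat.ceil_le.2 (by linarith), Nat.le_floor (by linarith)⟩
    · intro v hv w hw hvw
      have hne : ∀ j, j ≠ o → v j = w j := fun j hj => by
        have := congrFun hvw j
        simpa [hj] using this
      ext j
      by_cases hj : j = o
      · subst hj
        have h1 := hS v hv
        have h2 := hS w hw
        rw [Finsupp.degree_eq_sum, ← Finset.add_sum_erase _ _ (Finset.mem_univ j)] at h1 h2
        have : ∑ i ∈ Finset.univ.erase j, v i = ∑ i ∈ Finset.univ.erase j, w i :=
          Finset.sum_congr rfl fun i hi => hne i (Finset.ne_of_mem_erase hi)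
        omega
      · exact hne j hj
  calc (S.card : ℝ) ≤ ((Fintype.piFinset A).card : ℝ) := by exact_mod_cast h1
    _ = ∏ j, ((A j).card : ℝ) := by rw [Fintype.card_piFinset]; push_cast; rfl
    _ ≤ _ := by
      refine Finset.prod_le_prod (fun j _ => Nat.cast_nonneg _) fun j _ => ?_
      by_cases hj : j = o
      · simp only [A, hj, if_true, Finset.card_singleton, Nat.cast_one]
        linarith [ht o]
      · simp only [A, hj, if_false]
        exact card_natIcc_le (ht j)

/-- The side of the box grows like `√(L a)` while the Gaussian integral decays like `√(k / a)`.
Their product is bounded independently of the column sum `a`, which keeps `n` out of the final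
estimate. -/
lemma box_side_mul_gaussian_le {k a L : ℝ} (hk : 1 ≤ k) (ha : 0 ≤ a) (hL : 1 ≤ L) :
    (2 * (4 * √(L * a) + 8 * L) + 1) * ((2 * Real.pi)⁻¹ *
      ∫ t in Set.Ioc (-Real.pi) Real.pi, Real.exp (-(1 / k / 10 * a) * t ^ 2)) ≤ 25 * k * L := by
  have hpi := Real.pi_pos
  set β := (2 * Real.pi)⁻¹ *
      ∫ t in Set.Ioc (-Real.pi) Real.pi, Real.exp (-(1 / k / 10 * a) * t ^ 2) with hβ
  have hβ1 : β ≤ 1 := by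
    rw [hβ, inv_mul_le_iff₀ (by positivity), mul_one]
    exact integral_Ioc_gaussian_le (by positivity)
  have hβ2 : √(L * a) * β ≤ √(k * L) := by
    rcases ha.eq_or_lt with rfl | ha'
    · simp
    · have h1 := integral_Ioc_gaussian_le_sqrt (b := 1 / k / 10 * a) (by positivity)
      have h2 : β ≤ (2 * Real.pi)⁻¹ * √(Real.pi / (1 / k / 10 * a)) :=
        mul_le_mul_of_nonneg_left h1 (by positivity)
      refine (mul_le_mul_of_nonneg_left h2 (Real.sqrt_nonneg _)).trans ?_
      rw [mul_left_comm, ← Real.sqrt_mul (by positivity), inv_mul_le_iff₀ (by positivity)]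
      rw [show L * a * (Real.pi / (1 / k / 10 * a)) = (10 * Real.pi) * (k * L) by field_simp,
        Real.sqrt_mul (by positivity)]
      refine mul_le_mul_of_nonneg_right ?_ (Real.sqrt_nonneg _)
      rw [Real.sqrt_le_left (by positivity)]
      nlinarith [Real.pi_gt_three]
  have hkL : 1 ≤ k * L := one_le_mul_of_one_le_of_one_le hk hL
  have hsq : √(k * L) ≤ k * L := by
    rw [Real.sqrt_le_left (by linarith)]
    nlinarith
  have h3 : (16 * L + 1) * β ≤ 17 * L := by
    have := mul_le_mul_of_nonneg_left hβ1 (show 0 ≤ 16 * L + 1 by linarith)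
    linarith
  have h4 : L ≤ k * L := le_mul_of_one_le_left (by linarith) hk
  calc _ = 8 * (√(L * a) * β) + (16 * L + 1) * β := by ring
    _ ≤ 8 * (k * L) + 17 * (k * L) := by linarith
    _ = _ := by ring

/-- Coefficientwise distance of two products of linear forms with matching low moments. -/
theorem coeffNorm_prod_linForm_sub_le {G : Type*} [Fintype G] {k m : ℕ} (hk : 1 ≤ k) (hm : 1 ≤ m)
    {o : Fin k} {x q : G → Fin k → ℝ} (hx : ∀ i, x i ∈ stdSimplex ℝ (Fin k))
    (hq : ∀ i, q i ∈ stdSimplex ℝ (Fin k)) {B δ r ρ L : ℝ} (hL : 1 ≤ L)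
    (hxo : ∀ i, 1 / (k : ℝ) ≤ x i o) (hqo : ∀ i, 1 / (k : ℝ) ≤ q i o)
    (hmom : ∀ r ≤ m, ∀ f : Fin r → Fin k, ∑ i, ∏ t, q i (f t) = ∑ i, ∏ t, x i (f t))
    (hB : 0 ≤ B) (hr : 0 ≤ r) (hδ : 0 ≤ δ) (hρ : r + 4 * k * δ ≤ ρ) (hρ' : ρ ≤ 1 / 2)
    (hcol : ∀ j, j ≠ o → B ≤ ∑ i, x i j ∨ ∀ i, x i j ≤ δ ∧ q i j ≤ δ) :
    coeffNorm (∏ i, linForm (x i) - ∏ i, linForm (q i)) ≤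
      (20 * k * ρ ^ (m - 1) + 2 * Real.exp (-(B * r ^ 2 / (10 * k)))) * (25 * k * L) ^ k +
        4 * k * Real.exp (-(4 * L)) := by
  classical
  have hkR : (1 : ℝ) ≤ k := by exact_mod_cast hk
  have hL0 : 0 < L := by linarith
  set F := ∏ i, linForm (x i) with hF
  set H := ∏ i, linForm (q i) with hH
  set τ := 20 * k * ρ ^ (m - 1) + 2 * Real.exp (-(B * r ^ 2 / (10 * k))) with hτ
  have hρ0 : 0 ≤ ρ := le_trans (by positivity) hρ
  have hτ0 : 0 ≤ τ := by positivity
  set a := columnSum o x with ha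
  have ha0 : ∀ j, 0 ≤ a j := columnSum_nonneg o hx
  set t : Fin k → ℝ := fun j => 4 * √(L * a j) + 8 * L with ht
  have ht0 : ∀ j, 0 ≤ t j := fun j => by simp only [ht]; positivity
  have hsq : ∀ j, ∑ i, q i j = ∑ i, x i j := fun j => by simpa using hmom 1 hm fun _ => j
  have haj : ∀ j, j ≠ o → a j = ∑ i, x i j := fun j hj => by simp [ha, columnSum, hj]
  have hhom : (F - H).IsHomogeneous (Fintype.card G) :=
    (isHomogeneous_prod_linForm x).sub (isHomogeneous_prod_linForm q)
  set S := (F - H).support with hS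
  have hcoef : ∀ v ∈ S, |(F - H).coeff v| ≤ τ * ∏ j, ((2 * Real.pi)⁻¹ *
      ∫ t in Set.Ioc (-Real.pi) Real.pi, Real.exp (-(1 / k / 10 * a j) * t ^ 2)) := by
    intro v hv
    refine abs_coeff_le_of_torus_bound o (F - H) hhom
      (fun j (t : ℝ) => Real.exp (-(1 / k / 10 * a j) * t ^ 2)) (fun j => by fun_prop) ?_ v
      (MvPolynomial.mem_support_iff.1 hv)
    intro θ hθ
    refine (norm_eval₂_sub_le hm hx hq (show 0 < 1 / (k : ℝ) by positivity) hxo hqo hmom hB hr hδ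
      hρ hρ' hcol hθ).trans (le_of_eq ?_)
    rw [hτ]
    congr 3
    · field_simp
    · congr 2; field_simp
  -- Inside the box the uniform Fourier bound is multiplied by the number of lattice points; outside
  -- it, the two laws are bounded separately by their tails, having equal column sums.
  set P : (Fin k →₀ ℕ) → Prop := fun v => ∀ j, j ≠ o → |(v j : ℝ) - a j| ≤ t j with hP
  have hin : ∑ v ∈ S.filter P, |(F - H).coeff v| ≤ τ * (25 * k * L) ^ k := by
    have hcard := card_box_le (N := Fintype.card G) o a t ht0 (S.filter P)
      (fun v hv => degree_eq_of_coeff_ne_zero hhom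
        (MvPolynomial.mem_support_iff.1 (Finset.mem_filter.1 hv).1))
      (fun v hv => (Finset.mem_filter.1 hv).2)
    have hβ0 : ∀ j, 0 ≤ (2 * Real.pi)⁻¹ *
      ∫ t in Set.Ioc (-Real.pi) Real.pi, Real.exp (-(1 / k / 10 * a j) * t ^ 2) := fun j =>
      mul_nonneg (by positivity) (integral_nonneg fun t => (Real.exp_pos _).le)
    refine (Finset.sum_le_card_nsmul _ _ _ fun v hv => hcoef v (Finset.mem_filter.1 hv).1).trans ?_
    rw [nsmul_eq_mul]
    refine (mul_le_mul_of_nonneg_right hcard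
      (mul_nonneg hτ0 (Finset.prod_nonneg fun j _ => hβ0 j))).trans ?_
    rw [mul_left_comm, ← Finset.prod_mul_distrib]
    refine mul_le_mul_of_nonneg_left ?_ hτ0
    have := Finset.prod_le_prod (s := (Finset.univ : Finset (Fin k)))
      (fun j _ => mul_nonneg (show 0 ≤ 2 * t j + 1 by linarith [ht0 j]) (hβ0 j))
      (fun j _ => box_side_mul_gaussian_le hkR (ha0 j) hL)
    simpa using this
  have hout : ∑ v ∈ S.filter (fun v => ¬ P v), |(F - H).coeff v| ≤
      4 * k * Real.exp (-(4 * L)) := by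
    have hFn : ∀ v, 0 ≤ F.coeff v := fun v => coeff_prod_linForm_nonneg _ x hx v
    have hHn : ∀ v, 0 ≤ H.coeff v := fun v => coeff_prod_linForm_nonneg _ q hq v
    have hsub : S.filter (fun v => ¬ P v) ⊆ (Finset.univ.erase o).biUnion fun j =>
        S.filter fun v => t j < |(v j : ℝ) - ∑ i, x i j| := by
      intro v hv
      obtain ⟨hvS, hvP⟩ := Finset.mem_filter.1 hv
      simp only [hP, not_forall, not_le] at hvP
      obtain ⟨j, hj, hlt⟩ := hvP
      rw [haj j hj] at hlt
      simp only [Finset.mem_biUnion, Finset.mem_erase, Finset.mem_univ, and_true,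
        Finset.mem_filter]
      exact ⟨j, hj, hvS, hlt⟩
    have habs : ∀ v, |(F - H).coeff v| ≤ F.coeff v + H.coeff v := fun v => by
      rw [MvPolynomial.coeff_sub]
      exact (abs_sub _ _).trans (by rw [abs_of_nonneg (hFn v), abs_of_nonneg (hHn v)])
    have hcol1 : ∀ j ∈ Finset.univ.erase o,
        ∑ v ∈ S.filter (fun v => t j < |(v j : ℝ) - ∑ i, x i j|), |(F - H).coeff v| ≤
          4 * Real.exp (-(4 * L)) := by
      intro j hj
      have hj' := haj j (Finset.ne_of_mem_erase hj)
      obtain ⟨l, hl0, hl1, hl⟩ := exists_chernoff_parameter (s := a j) hL0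
      have h1 := sum_coeff_tail_le hx j (t := t j) hl0 hl1 (by rw [← hj']; exact hl) S
      have h2 := sum_coeff_tail_le hq j (t := t j) hl0 hl1 (by rw [hsq, ← hj']; exact hl) S
      rw [hsq] at h2
      refine (Finset.sum_le_sum fun v _ => habs v).trans ?_
      rw [Finset.sum_add_distrib]
      linarith
    refine (Finset.sum_le_sum_of_subset_of_nonneg hsub fun _ _ _ => abs_nonneg _).trans ?_
    refine (sum_biUnion_le_sum _ _ fun _ => abs_nonneg _).trans ?_
    refine (Finset.sum_le_card_nsmul _ _ _ hcol1).trans ?_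
    rw [nsmul_eq_mul]
    have h3 : ((Finset.univ.erase o).card : ℝ) ≤ k := by
      exact_mod_cast (Finset.card_le_univ _).trans (by simp)
    have := mul_le_mul_of_nonneg_right h3 (show 0 ≤ 4 * Real.exp (-(4 * L)) by positivity)
    linarith
  rw [coeffNorm, ← Finset.sum_filter_add_sum_filter_not S P]
  exact add_le_add hin hout

/-! ### Setting rows aside, choosing parameters, and assembling the groups. -/

/-- A bad column has sum below `B` but an entry above `δ`. Discarding the rows with such entries
removes at most `B / δ` rows and makes the column small for good, even though other columns may
cease to be heavy. `T` records the columns already small, and `d` bounds the number of rounds left.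
-/
lemma exists_subset_light_or_small {G κ : Type*} [DecidableEq G] [Fintype κ] [DecidableEq κ]
    (x : G → κ → ℝ) (hx : ∀ i j, 0 ≤ x i j) {B δ : ℝ} (d : ℕ) :
    ∀ (T : Finset κ) (S : Finset G), Tᶜ.card ≤ d → (∀ j ∈ T, ∀ i ∈ S, x i j ≤ δ) → 0 ≤ B →
      ∃ S' ⊆ S, δ * (S \ S').card ≤ d * B ∧
        ∀ j, B ≤ ∑ i ∈ S', x i j ∨ ∀ i ∈ S', x i j ≤ δ := by
  induction d with
  | zero =>
    intro T S hT hTS _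
    refine ⟨S, subset_rfl, by simp, fun j => Or.inr (hTS j ?_)⟩
    have : Tᶜ = ∅ := Finset.card_eq_zero.1 (Nat.le_zero.1 hT)
    rw [Finset.compl_eq_empty_iff] at this
    simp [this]
  | succ d ih =>
    intro T S hT hTS hB
    by_cases hgood : ∀ j, B ≤ ∑ i ∈ S, x i j ∨ ∀ i ∈ S, x i j ≤ δ
    · exact ⟨S, subset_rfl, by simp; positivity, hgood⟩
    · push Not at hgood
      obtain ⟨j, hjB, i0, hi0, hi0δ⟩ := hgood
      have hjT : j ∉ T := fun h => absurd (hTS j h i0 hi0) (not_le.2 hi0δ)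
      set S1 := S.filter fun i => x i j ≤ δ with hS1
      have hT' : (insert j T)ᶜ.card ≤ d := by
        have h1 := Finset.card_compl_add_card T
        have h2 := Finset.card_compl_add_card (insert j T)
        rw [Finset.card_insert_of_notMem hjT] at h2
        omega
      obtain ⟨S', hS', hcard, hgood'⟩ := ih (insert j T) S1 hT' (by
        intro a ha i hi
        rw [hS1, Finset.mem_filter] at hi
        rcases Finset.mem_insert.1 ha with rfl | ha
        · exact hi.2
        · exact hTS a ha i hi.1) hB
      refine ⟨S', hS'.trans (Finset.filter_subset _ _), ?_, hgood'⟩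
      have hrem : δ * (S \ S1).card ≤ B := by
        have h1 : ∀ i ∈ S \ S1, δ ≤ x i j := by
          intro i hi
          rw [Finset.mem_sdiff, hS1, Finset.mem_filter, not_and, not_le] at hi
          exact (hi.2 hi.1).le
        have h2 := Finset.card_nsmul_le_sum _ _ _ h1
        rw [nsmul_eq_mul, mul_comm] at h2
        exact h2.trans ((Finset.sum_le_sum_of_subset_of_nonneg Finset.sdiff_subset
          fun i _ _ => hx i j).trans hjB.le)
      have hsplit : (S \ S').card = (S \ S1).card + (S1 \ S').card := by
        have h1 := Finset.card_sdiff_add_card_eq_card (hS'.trans (Finset.filter_subset _ _) : S' ⊆ S)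
        have h2 := Finset.card_sdiff_add_card_eq_card (Finset.filter_subset (fun i => x i j ≤ δ) S)
        have h3 := Finset.card_sdiff_add_card_eq_card hS'
        rw [← hS1] at h2
        omega
      rw [hsplit]
      push_cast
      linarith

/-- Here `M = m - 1`, `B = 5000 k ^ 5 L ^ 2`, `r = 1 / (4 k √L)` and `ρ = 1 / (2 k √L)`. The three
errors are at most a quarter, a quarter and a half of `exp (-L)`. -/
lemma group_error_le {k M : ℕ} (hk : 3 ≤ k) {L : ℝ} (hL : 1 < L) (hkL : (k : ℝ) ≤ Real.exp L)
    (hM : 8 * (L / Real.log L + k) ≤ M) :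
    (20 * k * (1 / (2 * k * √L)) ^ M + 2 * Real.exp (-(5000 * k ^ 5 * L ^ 2 *
      (1 / (4 * k * √L)) ^ 2 / (10 * k)))) * (25 * k * L) ^ k + 4 * k * Real.exp (-(4 * L)) ≤
      Real.exp (-L) := by
  have hkR : (3 : ℝ) ≤ k := by exact_mod_cast hk
  have hk0 : (0 : ℝ) < k := by linarith
  have hL0 : 0 < L := by linarith
  have hlog : 0 < Real.log L := Real.log_pos hL
  have hsq : √L ^ 2 = L := Real.sq_sqrt hL0.le
  have hsq1 : 1 ≤ √L := Real.one_le_sqrt.2 hL.le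
  have heL : 3 ≤ Real.exp L := hkR.trans hkL
  have hk2 : (k : ℝ) ≤ 2 ^ k := by exact_mod_cast Nat.lt_two_pow_self.le
  set E := Real.exp L with hE
  have hE0 : 0 < E := Real.exp_pos L
  have hexp : Real.exp (-L) = E⁻¹ := Real.exp_neg L
  have h25 : 0 < 25 * k * L := by positivity
  -- Gaussian tail outside the central region
  have hA : 2 * Real.exp (-(5000 * k ^ 5 * L ^ 2 * (1 / (4 * k * √L)) ^ 2 / (10 * k))) *
      (25 * k * L) ^ k ≤ E⁻¹ / 4 := by
    have h1 : 5000 * (k : ℝ) ^ 5 * L ^ 2 * (1 / (4 * k * √L)) ^ 2 / (10 * k) =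
        125 / 4 * (k ^ 2 * L) := by
      rw [div_pow, mul_pow, hsq]; field_simp; ring
    have h2 : (25 * k * L) ^ k ≤ Real.exp (25 * (k ^ 2 * L)) := by
      have := pow_le_pow_left₀ h25.le
        ((le_add_of_nonneg_right zero_le_one).trans (Real.add_one_le_exp (25 * k * L))) k
      rw [← Real.exp_nat_mul] at this
      exact this.trans (le_of_eq (by congr 1; ring))
    have h3 : (8 : ℝ) ≤ Real.exp 3 := by
      have := Real.add_one_le_exp (1 : ℝ)
      have h4 := pow_le_pow_left₀ (by norm_num) this 3
      rw [← Real.exp_nat_mul] at h4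
      norm_num at h4 ⊢
      linarith
    rw [h1, ← hexp]
    -- The size of `B` is dictated here: the exponent must beat `25 k ^ 2 L`, the cost of the factor
    -- `(25 k L) ^ k`.
    have h4 : L + 3 + 25 * (k ^ 2 * L) ≤ 125 / 4 * ((k : ℝ) ^ 2 * L) := by
      have : (9 : ℝ) ≤ k ^ 2 := by nlinarith
      nlinarith
    calc 2 * Real.exp (-(125 / 4 * (k ^ 2 * L))) * (25 * k * L) ^ k
        ≤ 2 * Real.exp (-(125 / 4 * (k ^ 2 * L))) * Real.exp (25 * (k ^ 2 * L)) :=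
          mul_le_mul_of_nonneg_left h2 (by positivity)
      _ = 2 * Real.exp (-(125 / 4 * (k ^ 2 * L)) + 25 * (k ^ 2 * L)) := by
          rw [mul_assoc, ← Real.exp_add]
      _ ≤ 2 * Real.exp (-L - 3) := by
          refine mul_le_mul_of_nonneg_left (Real.exp_le_exp.2 ?_) zero_le_two
          linarith
      _ = 2 * (Real.exp (-L) / Real.exp 3) := by rw [Real.exp_sub]
      _ ≤ 2 * (Real.exp (-L) / 8) := by
          refine mul_le_mul_of_nonneg_left ?_ zero_le_two
          exact div_le_div_of_nonneg_left (Real.exp_pos _).le (by norm_num) h3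
      _ = _ := by ring
  -- Taylor remainder inside the central region
  have hB : 20 * k * (1 / (2 * k * √L)) ^ M * (25 * k * L) ^ k ≤ E⁻¹ / 4 := by
    set D := 2 * k * √L with hD
    have hD1 : √L ≤ D := by rw [hD]; nlinarith
    have hD6 : 1 < D := by rw [hD]; nlinarith
    -- Source of the rate `L / log L`: since `ρ⁻¹ = D ≥ √L`, that many powers of `D` already yield
    -- `exp L` up to constants in the exponent. The `8 k` further powers pay for `80 k (25 k L) ^
    -- k`.
    have hlogD : Real.log L / 2 ≤ Real.log D := by
      rw [← Real.log_sqrt hL0.le]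
      exact Real.log_le_log (by positivity) hD1
    have hlogD0 : 0 < Real.log D := Real.log_pos hD6
    have hD8 : 25 * k * L * 240 ≤ D ^ 8 := by
      have h1 : D ^ 8 = 256 * k ^ 8 * L ^ 4 := by
        rw [hD, mul_pow, mul_pow, show √L ^ 8 = (√L ^ 2) ^ 4 by ring, hsq]; norm_num
      rw [h1]
      have h2 : (3 : ℝ) ^ 7 ≤ k ^ 7 := pow_le_pow_left₀ (by norm_num) hkR 7
      have h3 : (1 : ℝ) ≤ L ^ 3 := one_le_pow₀ hL.le
      have h4 : (3 : ℝ) ^ 7 * 1 ≤ k ^ 7 * L ^ 3 := mul_le_mul h2 h3 zero_le_one (by positivity)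
      have h5 : (24 : ℝ) * 250 ≤ 256 * (k ^ 7 * L ^ 3) := by norm_num at h4 ⊢; linarith
      have h6 := mul_le_mul_of_nonneg_right h5 (show (0 : ℝ) ≤ k * L by positivity)
      nlinarith
    have hpow : 80 * k * (25 * k * L) ^ k ≤ (D ^ 8) ^ k := by
      refine le_trans ?_ (pow_le_pow_left₀ (by positivity) hD8 k)
      rw [mul_pow _ (240 : ℝ), mul_comm]
      refine mul_le_mul_of_nonneg_left ?_ (by positivity)
      have h1 : (80 : ℝ) ≤ 80 ^ k := le_self_pow₀ (by norm_num) (by omega)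
      have h2 : (k : ℝ) ≤ 3 ^ k := hk2.trans (pow_le_pow_left₀ (by norm_num) (by norm_num) k)
      calc 80 * (k : ℝ) ≤ 80 ^ k * 3 ^ k := mul_le_mul h1 h2 hk0.le (by positivity)
        _ = 240 ^ k := by rw [← mul_pow]; norm_num
    have hDM : 80 * k * (25 * k * L) ^ k * E ≤ D ^ M := by
      have h1 : L + 8 * k * Real.log D ≤ M * Real.log D := by
        have h2 := mul_le_mul_of_nonneg_right hM hlogD0.le
        have h3 : L / Real.log L * (Real.log L / 2) ≤ L / Real.log L * Real.log D :=
          mul_le_mul_of_nonneg_left hlogD (by positivity)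
        have h4 : L / Real.log L * (Real.log L / 2) = L / 2 := by field_simp
        nlinarith
      have h2 := Real.exp_le_exp.2 h1
      have hD0 : 0 < D := by linarith
      rw [Real.exp_add, Real.exp_nat_mul, Real.exp_log hD0] at h2
      have h3 : Real.exp (8 * k * Real.log D) = (D ^ 8) ^ k := by
        rw [← pow_mul, ← Real.exp_log (pow_pos hD0 (8 * k)), Real.log_pow]
        push_cast
        rfl
      rw [h3, ← hE] at h2
      calc _ ≤ (D ^ 8) ^ k * E := mul_le_mul_of_nonneg_right hpow hE0.le
        _ = E * (D ^ 8) ^ k := mul_comm _ _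
        _ ≤ _ := h2
    have hDp : 0 < D ^ M := by positivity
    rw [div_pow, one_pow, mul_one_div, div_mul_eq_mul_div, div_le_iff₀ hDp]
    have : E⁻¹ / 4 * (80 * k * (25 * k * L) ^ k * E) ≤ E⁻¹ / 4 * D ^ M :=
      mul_le_mul_of_nonneg_left hDM (by positivity)
    refine le_trans (le_of_eq ?_) this
    field_simp
    norm_num
  -- Chernoff tail
  have hC : 4 * k * Real.exp (-(4 * L)) ≤ E⁻¹ / 2 := by
    have h1 : Real.exp (-(4 * L)) = (E ^ 4)⁻¹ := by
      rw [Real.exp_neg, hE, ← Real.exp_nat_mul]; norm_num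
    rw [h1, ← div_eq_mul_inv, div_le_div_iff₀ (by positivity) (by norm_num)]
    have h2 : E⁻¹ * E ^ 4 = E ^ 3 := by field_simp
    rw [h2]
    have h3 : 9 * E ≤ E ^ 3 := by nlinarith [mul_self_nonneg (E - 3), mul_pos hE0 hE0]
    linarith
  rw [hexp, add_mul]
  linarith

lemma coeffNorm_prod_linForm_replace_le {G : Type*} [Fintype G] [DecidableEq G] {k : ℕ}
    (S : Finset G) {p q : G → Fin k → ℝ} (hp : ∀ i, p i ∈ stdSimplex ℝ (Fin k))
    (hpq : ∀ i, i ∉ S → q i = p i) :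
    coeffNorm (∏ i, linForm (p i) - ∏ i, linForm (q i)) ≤
      coeffNorm (∏ i : S, linForm (p i) - ∏ i : S, linForm (q i)) := by
  have h1 : ∀ y : G → Fin k → ℝ, ∏ i, linForm (y i) =
      (∏ i : S, linForm (y i)) * ∏ i ∈ Sᶜ, linForm (y i) := fun y => by
    rw [← Finset.prod_mul_prod_compl S, Finset.prod_coe_sort S fun i => linForm (y i)]
  have h2 : ∏ i ∈ Sᶜ, linForm (q i) = ∏ i ∈ Sᶜ, linForm (p i) :=
    Finset.prod_congr rfl fun i hi => by rw [hpq i (Finset.mem_compl.1 hi)]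
  rw [h1 p, h1 q, h2, ← sub_mul]
  refine (coeffNorm_mul_le _ _).trans (mul_le_of_le_one_right (coeffNorm_nonneg _) ?_)
  exact coeffNorm_prod_le_one _ _ fun i _ => coeffNorm_linForm_le (hp i)

/-- Rows sharing a coordinate of mass at least `1 / k` can be replaced by few distinct rows. -/
theorem exists_few_values_of_common_coordinate {G : Type*} [Fintype G] {k M : ℕ} (hk : 3 ≤ k)
    {L : ℝ} (hL : 1 < L) (hkL : (k : ℝ) ≤ Real.exp L) (hM : 8 * (L / Real.log L + k) ≤ M)
    (o : Fin k) (p : G → Fin k → ℝ) (hp : ∀ i, p i ∈ stdSimplex ℝ (Fin k))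
    (hpo : ∀ i, 1 / (k : ℝ) ≤ p i o) :
    ∃ q : G → Fin k → ℝ, (∀ i, q i ∈ stdSimplex ℝ (Fin k)) ∧
      coeffNorm (∏ i, linForm (p i) - ∏ i, linForm (q i)) ≤ Real.exp (-L) ∧
      ((Set.range q).ncard : ℝ) ≤ (3 * (M + 1)) ^ k + 80000 * k ^ 8 * L ^ 2 * √L := by
  classical
  have hkR : (3 : ℝ) ≤ k := by exact_mod_cast hk
  have hk0 : (0 : ℝ) < k := by linarith
  have hL0 : 0 < L := by linarith
  have hsq : √L ^ 2 = L := Real.sq_sqrt hL0.le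
  have hsq1 : 1 ≤ √L := Real.one_le_sqrt.2 hL.le
  set B : ℝ := 5000 * k ^ 5 * L ^ 2 with hB
  set δ : ℝ := 1 / (16 * k ^ 2 * √L) with hδ
  have hB0 : 0 ≤ B := by positivity
  have hδ0 : 0 < δ := by positivity
  obtain ⟨S, -, hcard, hgood⟩ := exists_subset_light_or_small p (fun i j => (hp i).1 j) (B := B)
    (δ := δ) k ∅ Finset.univ (by simp) (by simp) hB0
  -- The box forces the replacement rows to inherit the mass `1 / k` at `o` and the bound `δ` on
  -- small columns, neither of which follows from moments alone.
  set l : Fin k → ℝ := fun j => if j = o then 1 / k else 0 with hl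
  set u : Fin k → ℝ := fun j => if j ≠ o ∧ ∑ i ∈ S, p i j < B then δ else 1 with hu
  have hle1 : ∀ i j, p i j ≤ 1 := fun i j => by
    rw [← (hp i).2]
    exact Finset.single_le_sum (fun a _ => (hp i).1 a) (Finset.mem_univ j)
  have hl0 : ∀ j, 0 ≤ l j := fun j => by
    simp only [hl]; split_ifs
    · positivity
    · exact le_rfl
  have hbox : ∀ i : S, p i ∈ boxSimplex l u := by
    intro i
    refine ⟨fun j => ⟨?_, ?_⟩, (hp i).2⟩
    · simp only [hl]
      split_ifs with h
      · subst h; exact hpo i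
      · exact (hp i).1 j
    · simp only [hu]
      split_ifs with h
      · exact (hgood j).resolve_left (not_le.2 h.2) i i.2
      · exact hle1 i j
  obtain ⟨q', hq', hcount, hmom⟩ := exists_few_values_same_moments (m := M + 1) (by omega) hl0
    (fun i : S => p i) hbox
  have hq's : ∀ i, q' i ∈ stdSimplex ℝ (Fin k) := fun i =>
    ⟨fun j => (hl0 j).trans ((hq' i).1 j).1, (hq' i).2⟩
  set q : G → Fin k → ℝ := fun i => if h : i ∈ S then q' ⟨i, h⟩ else p i with hq
  have hqS : ∀ i : S, q i = q' i := fun i => by simp [hq]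
  have hqs : ∀ i, q i ∈ stdSimplex ℝ (Fin k) := by
    intro i
    simp only [hq]
    split_ifs
    · exact hq's _
    · exact hp i
  refine ⟨q, hqs, ?_, ?_⟩
  · refine (coeffNorm_prod_linForm_replace_le S hp fun i hi => by simp [hq, hi]).trans ?_
    simp_rw [hqS]
    refine le_trans ?_ (group_error_le hk hL hkL hM)
    have h := coeffNorm_prod_linForm_sub_le (by omega) (by omega) (o := o)
      (fun i : S => hp i) hq's hL.le (fun i => hpo i)
      (fun i => by simpa [hl] using ((hq' i).1 o).1) hmom hB0
      (r := 1 / (4 * k * √L)) (δ := δ) (ρ := 1 / (2 * k * √L)) (by positivity) hδ0.le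
      (le_of_eq (by rw [hδ]; field_simp; ring)) (by
        rw [div_le_div_iff₀ (by positivity) (by norm_num)]; nlinarith) ?_
    · simpa using h
    · intro j hj
      rcases le_or_gt B (∑ i : S, p i j) with h | h
      · exact Or.inl h
      · refine Or.inr fun i => ?_
        have huj : u j = δ := by
          simp only [hu]
          rw [if_pos ⟨hj, by rwa [Finset.sum_coe_sort S fun i => p i j] at h⟩]
        exact ⟨huj ▸ ((hbox i).1 j).2, huj ▸ ((hq' i).1 j).2⟩
  · have hsub : Set.range q ⊆ Set.range q' ∪ ↑(Sᶜ.image p) := by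
      rintro _ ⟨i, rfl⟩
      by_cases h : i ∈ S
      · exact Or.inl ⟨⟨i, h⟩, (hqS ⟨i, h⟩).symm⟩
      · refine Or.inr ?_
        simp only [Finset.coe_image, Set.mem_image, Finset.coe_compl]
        exact ⟨i, by simpa using h, by simp [hq, h]⟩
    have h1 : (Set.range q).ncard ≤ (3 * (M + 1)) ^ k + Sᶜ.card := by
      refine (Set.ncard_le_ncard hsub ((Set.finite_range _).union (Finset.finite_toSet _))).trans ?_
      refine (Set.ncard_union_le _ _).trans (add_le_add hcount ?_)
      rw [Set.ncard_coe_finset]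
      exact Finset.card_image_le
    -- Rows set aside are left unchanged; there are at most `k B / δ` of them.
    have h2 : (Sᶜ.card : ℝ) ≤ 80000 * k ^ 8 * L ^ 2 * √L := by
      rw [← Finset.compl_eq_univ_sdiff, mul_comm, ← le_div_iff₀ hδ0] at hcard
      refine hcard.trans (le_of_eq ?_)
      rw [hδ, hB]
      field_simp
      ring
    calc ((Set.range q).ncard : ℝ) ≤ (((3 * (M + 1)) ^ k + Sᶜ.card : ℕ) : ℝ) := by exact_mod_cast h1
      _ ≤ _ := by push_cast; linarith

lemma exists_coordinate_ge {k : ℕ} (hk : 0 < k) {x : Fin k → ℝ} (hx : x ∈ stdSimplex ℝ (Fin k)) :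
    ∃ o, 1 / (k : ℝ) ≤ x o := by
  have : Nonempty (Fin k) := ⟨⟨0, hk⟩⟩
  have hk0 : (k : ℝ) ≠ 0 := by exact_mod_cast hk.ne'
  have h : ∑ _j : Fin k, 1 / (k : ℝ) ≤ ∑ j, x j := by
    rw [hx.2]; simp [hk0]
  obtain ⟨o, -, ho⟩ := Finset.exists_le_of_sum_le Finset.univ_nonempty h
  exact ⟨o, ho⟩

lemma exists_few_values_le_mul {n k M : ℕ} (hk : 3 ≤ k)
    {L : ℝ} (hL : 1 < L) (hkL : (k : ℝ) ≤ Real.exp L) (hM : 8 * (L / Real.log L + k) ≤ M)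
    (p : Fin n → Fin k → ℝ) (hp : ∀ i, p i ∈ stdSimplex ℝ (Fin k)) :
    ∃ q : Fin n → Fin k → ℝ, (∀ i, q i ∈ stdSimplex ℝ (Fin k)) ∧
      coeffNorm (∏ i, linForm (p i) - ∏ i, linForm (q i)) ≤ k * Real.exp (-L) ∧
      ((Set.range q).ncard : ℝ) ≤
        k * ((3 * (M + 1)) ^ k + 80000 * k ^ 8 * L ^ 2 * √L) := by
  classical
  choose c hc using fun i => exists_coordinate_ge (by omega) (hp i)
  have hgroup := fun o : Fin k => exists_few_values_of_common_coordinate (G := {i // c i = o})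
    hk hL hkL hM o (fun i => p i) (fun i => hp i) (fun i => by
      have := hc i
      rwa [i.2] at this)
  choose Q hQs hQn hQc using hgroup
  obtain ⟨q, hq⟩ : ∃ q : Fin n → Fin k → ℝ, ∀ i, q i = Q (c i) ⟨i, rfl⟩ := ⟨_, fun _ => rfl⟩
  have hqQ : ∀ o (i : {i // c i = o}), q i = Q o i := by
    rintro o ⟨i, rfl⟩; exact hq i
  have hqs : ∀ i, q i ∈ stdSimplex ℝ (Fin k) := fun i => hq i ▸ hQs _ _
  refine ⟨q, hqs, ?_, ?_⟩
  · obtain ⟨A, hA⟩ : ∃ A : Fin k → MvPolynomial (Fin k) ℝ,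
        ∀ o, A o = ∏ i : {i // c i = o}, linForm (p i) := ⟨_, fun _ => rfl⟩
    obtain ⟨D, hD⟩ : ∃ D : Fin k → MvPolynomial (Fin k) ℝ,
        ∀ o, D o = ∏ i : {i // c i = o}, linForm (q i) := ⟨_, fun _ => rfl⟩
    have hPA : ∏ i, linForm (p i) = ∏ o, A o := by
      rw [funext hA]
      exact (Fintype.prod_fiberwise c fun i => linForm (p i)).symm
    have hQD : ∏ i, linForm (q i) = ∏ o, D o := by
      rw [funext hD]
      exact (Fintype.prod_fiberwise c fun i => linForm (q i)).symm
    have hA1 : ∀ o ∈ Finset.univ, coeffNorm (A o) ≤ 1 := fun o _ => by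
      rw [hA]
      exact coeffNorm_prod_le_one _ _ fun i _ => coeffNorm_linForm_le (hp i)
    have hD1 : ∀ o ∈ Finset.univ, coeffNorm (D o) ≤ 1 := fun o _ => by
      rw [hD]
      exact coeffNorm_prod_le_one _ _ fun i _ => coeffNorm_linForm_le (hqs i)
    have hAD : ∀ o ∈ Finset.univ, coeffNorm (A o - D o) ≤ Real.exp (-L) := by
      intro o _
      rw [hA, hD]
      simp_rw [hqQ o]
      exact hQn o
    rw [hPA, hQD]
    refine (coeffNorm_prod_sub_prod_le _ _ _ hA1 hD1).trans ?_
    simpa using Finset.sum_le_card_nsmul _ _ _ hAD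
  · have hsub : Set.range q ⊆ ⋃ o, Set.range (Q o) := by
      rintro _ ⟨i, rfl⟩
      exact Set.mem_iUnion.2 ⟨c i, ⟨i, rfl⟩, (hq i).symm⟩
    have h1 : (Set.range q).ncard ≤ ∑ o, (Set.range (Q o)).ncard := by
      refine (Set.ncard_le_ncard hsub (Set.finite_iUnion fun o => Set.finite_range _)).trans ?_
      exact Set.ncard_iUnion_le_of_fintype _
    calc ((Set.range q).ncard : ℝ) ≤ ((∑ o, (Set.range (Q o)).ncard : ℕ) : ℝ) := by
          exact_mod_cast h1
      _ = ∑ o, ((Set.range (Q o)).ncard : ℝ) := by push_cast; rfl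
      _ ≤ _ := (Finset.sum_le_card_nsmul _ _ _ fun o _ => hQc o).trans
          (le_of_eq (by rw [nsmul_eq_mul, Finset.card_univ, Fintype.card_fin]))

lemma log_cube_le {L : ℝ} (hL : 1 < L) : Real.log L ^ 3 ≤ 216 * √L := by
  have hL0 : 0 < L := by linarith
  have h := Real.log_le_rpow_div hL0.le (show (0 : ℝ) < 1 / 6 by norm_num)
  have h1 := pow_le_pow_left₀ (Real.log_pos hL).le h 3
  refine h1.trans (le_of_eq ?_)
  rw [div_pow, ← Real.rpow_natCast, ← Real.rpow_mul hL0.le, Real.sqrt_eq_rpow]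
  norm_num
  ring

/-- Powers of `k` are absorbed into constants to the power `k`. The factor `L ^ (5 / 2)` is at most
`216 (L / log L) ^ 3`, and `3 ≤ k` turns the cube into a `k`-th power. -/
lemma count_le {k M : ℕ} (hk : 3 ≤ k) {L : ℝ} (hL : 1 < L)
    (hM : (M : ℝ) ≤ 8 * (L / Real.log L + k) + 1) :
    k * ((3 * (M + 1)) ^ k + 80000 * k ^ 8 * L ^ 2 * √L) ≤
      (200000 * (L / Real.log L + k)) ^ k := by
  have hkR : (3 : ℝ) ≤ k := by exact_mod_cast hk
  have hk0 : (0 : ℝ) < k := by linarith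
  have hL0 : 0 < L := by linarith
  have hlog : 0 < Real.log L := Real.log_pos hL
  have hsq : √L ^ 2 = L := Real.sq_sqrt hL0.le
  have hsq0 : 0 < √L := Real.sqrt_pos.2 hL0
  have hk2 : (k : ℝ) ≤ 2 ^ k := by exact_mod_cast Nat.lt_two_pow_self.le
  have hR0 : 0 < L / Real.log L := by positivity
  set W := L / Real.log L + k with hW
  have hW3 : 3 ≤ W := by linarith
  have h1 : (k : ℝ) * (3 * (M + 1)) ^ k ≤ (54 * W) ^ k := by
    have h2 : (3 * ((M : ℝ) + 1)) ^ k ≤ (27 * W) ^ k :=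
      pow_le_pow_left₀ (by positivity) (by linarith) k
    calc _ ≤ (2 : ℝ) ^ k * (27 * W) ^ k := mul_le_mul hk2 h2 (by positivity) (by positivity)
      _ = _ := by rw [← mul_pow]; ring_nf
  have h3 : L ^ 2 * √L ≤ 216 * W ^ k := by
    have h4 : L ^ 2 * √L ≤ 216 * (L / Real.log L) ^ 3 := by
      rw [div_pow, ← mul_div_assoc, le_div_iff₀ (by positivity)]
      calc L ^ 2 * √L * Real.log L ^ 3 ≤ L ^ 2 * √L * (216 * √L) :=
            mul_le_mul_of_nonneg_left (log_cube_le hL) (by positivity)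
        _ = 216 * (L ^ 2 * √L ^ 2) := by ring
        _ = 216 * L ^ 3 := by rw [hsq]; ring
    have h5 : (L / Real.log L) ^ 3 ≤ W ^ 3 := pow_le_pow_left₀ hR0.le (by linarith) 3
    have h6 : W ^ 3 ≤ W ^ k := pow_le_pow_right₀ (by linarith) hk
    linarith
  have h7 : (k : ℝ) * (80000 * k ^ 8 * L ^ 2 * √L) ≤ (153600 * W) ^ k := by
    have h8 : (k : ℝ) ^ 9 ≤ 512 ^ k := by
      refine (pow_le_pow_left₀ hk0.le hk2 9).trans (le_of_eq ?_)
      rw [← pow_mul, mul_comm, pow_mul]; norm_num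
    have h9 : (80000 * 216 : ℝ) ≤ 300 ^ k :=
      le_trans (by norm_num) (pow_le_pow_right₀ (by norm_num : (1 : ℝ) ≤ 300) hk)
    calc _ = 80000 * k ^ 9 * (L ^ 2 * √L) := by ring
      _ ≤ 80000 * k ^ 9 * (216 * W ^ k) := mul_le_mul_of_nonneg_left h3 (by positivity)
      _ = (80000 * 216) * k ^ 9 * W ^ k := by ring
      _ ≤ 300 ^ k * 512 ^ k * W ^ k := by gcongr
      _ = _ := by rw [← mul_pow, ← mul_pow]; norm_num
  rw [mul_add]
  refine (add_le_add h1 h7).trans ((pow_add_pow_le (by positivity) (by positivity)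
    (by omega)).trans ?_)
  exact pow_le_pow_left₀ (by positivity) (by linarith) k

/-! ### Translation between rows of probabilities and laws of random vectors. -/

/-- The law on `ℝ ^ k` giving mass `x j` to the unit vector `e j`. -/
noncomputable def categoricalLaw {k : ℕ} (x : Fin k → ℝ) : Measure (Fin k → ℝ) :=
  ∑ j, ENNReal.ofReal (x j) • Measure.dirac (Pi.single j 1)

lemma isProbabilityMeasure_categoricalLaw {k : ℕ} {x : Fin k → ℝ}
    (hx : x ∈ stdSimplex ℝ (Fin k)) : IsProbabilityMeasure (categoricalLaw x) := by
  refine ⟨?_⟩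
  simp only [categoricalLaw, Measure.coe_finsetSum, Finset.sum_apply, Measure.smul_apply,
    measure_univ, smul_eq_mul, mul_one]
  rw [← ENNReal.ofReal_sum_of_nonneg fun j _ => hx.1 j, hx.2, ENNReal.ofReal_one]

instance isFiniteMeasure_categoricalLaw {k : ℕ} (x : Fin k → ℝ) :
    IsFiniteMeasure (categoricalLaw x) := by
  refine ⟨?_⟩
  simp only [categoricalLaw, Measure.coe_finsetSum, Finset.sum_apply, Measure.smul_apply,
    measure_univ, smul_eq_mul, mul_one]
  exact ENNReal.sum_lt_top.2 fun j _ => ENNReal.ofReal_lt_top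

lemma IsCRV.exists_map_eq {Ω : Type*} [MeasurableSpace Ω] {k : ℕ} {X : Ω → Fin k → ℝ}
    {μ : Measure Ω} [IsProbabilityMeasure μ] (hX : IsCRV X μ) :
    ∃ x ∈ stdSimplex ℝ (Fin k), μ.map X = categoricalLaw x := by
  classical
  obtain ⟨hm, hae⟩ := hX
  have hmeas : ∀ j : Fin k, MeasurableSet (X ⁻¹' {Pi.single j 1}) := fun j =>
    hm (measurableSet_singleton _)
  have hmap : μ.map X = categoricalLaw fun j => μ.real (X ⁻¹' {Pi.single j 1}) := by
    ext A hA
    have h1 : ∀ᵐ ω ∂μ, (X ⁻¹' A).indicator (1 : Ω → ENNReal) ω =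
        ∑ j, (X ⁻¹' {Pi.single j 1}).indicator 1 ω *
          A.indicator (1 : (Fin k → ℝ) → ENNReal) (Pi.single j 1) := by
      filter_upwards [hae] with ω hω
      obtain ⟨j, hj⟩ := hω
      rw [Finset.sum_eq_single j]
      · simp only [Set.indicator_apply, Set.mem_preimage, Set.mem_singleton_iff, hj, if_true,
          Pi.one_apply, one_mul]
      · intro i _ hij
        have hne : X ω ≠ Pi.single i 1 := by
          rw [hj]
          intro h
          have := congrFun h i
          simp [hij] at this
        simp [hne]
      · simp
    rw [Measure.map_apply hm hA, ← lintegral_indicator_one (hm hA), lintegral_congr_ae h1,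
      lintegral_finsetSum _ fun j _ => by
        exact (measurable_one.indicator (hmeas j)).mul_const _]
    simp only [categoricalLaw, Measure.coe_finsetSum, Finset.sum_apply, Measure.smul_apply,
      smul_eq_mul]
    refine Finset.sum_congr rfl fun j _ => ?_
    rw [lintegral_mul_const _ (measurable_one.indicator (hmeas j)),
      lintegral_indicator_one (hmeas j), Measure.dirac_apply' _ hA, ofReal_measureReal]
  refine ⟨_, ⟨fun j => measureReal_nonneg, ?_⟩, hmap⟩
  have h1 : (μ.map X) Set.univ = 1 := by
    rw [Measure.map_apply hm MeasurableSet.univ]; simp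
  rw [hmap] at h1
  simp only [categoricalLaw, Measure.coe_finsetSum, Finset.sum_apply, Measure.smul_apply,
    measure_univ, smul_eq_mul, mul_one] at h1
  rw [← ENNReal.ofReal_sum_of_nonneg fun j _ => measureReal_nonneg] at h1
  exact ENNReal.ofReal_eq_one.1 h1

/-- The law of a sum of independent categorical variables with rows `p`. -/
noncomputable def multinomialLaw {n k : ℕ} (p : Fin n → Fin k → ℝ) : Measure (Fin k → ℝ) :=
  (Measure.pi fun i => categoricalLaw (p i)).map fun z => ∑ i, z i

lemma IsPMD.exists_map_eq {Ω : Type*} [MeasurableSpace Ω] {n k : ℕ} {X : Ω → Fin k → ℝ}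
    {μ : Measure Ω} [IsProbabilityMeasure μ] (hX : IsPMD n X μ) :
    ∃ p : Fin n → Fin k → ℝ, (∀ i, p i ∈ stdSimplex ℝ (Fin k)) ∧ μ.map X = multinomialLaw p := by
  obtain ⟨Z, hcrv, hind, rfl⟩ := hX
  choose p hp hlaw using fun i => (hcrv i).exists_map_eq
  refine ⟨p, hp, ?_⟩
  have h := (iIndepFun_iff_map_fun_eq_pi_map fun i => (hcrv i).1.aemeasurable).1 hind
  simp_rw [hlaw] at h
  rw [multinomialLaw, ← h, Measure.map_map (by fun_prop)
    (measurable_pi_lambda _ fun i => (hcrv i).1)]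
  congr 1
  ext ω
  simp [Finset.sum_apply]

lemma pi_categoricalLaw {n k : ℕ} {p : Fin n → Fin k → ℝ}
    (hp : ∀ i, p i ∈ stdSimplex ℝ (Fin k)) :
    Measure.pi (fun i => categoricalLaw (p i)) =
      ∑ ω : Fin n → Fin k, ENNReal.ofReal (∏ i, p i (ω i)) •
        Measure.dirac (fun i => (Pi.single (ω i) 1 : Fin k → ℝ)) := by
  refine Measure.pi_eq fun s hs => ?_
  simp only [categoricalLaw, Measure.coe_finsetSum, Finset.sum_apply, Measure.smul_apply,
    smul_eq_mul]
  rw [Finset.prod_univ_sum, Fintype.piFinset_univ]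
  refine Finset.sum_congr rfl fun ω _ => ?_
  rw [ENNReal.ofReal_prod_of_nonneg fun i _ => (hp i).1 _, Finset.prod_mul_distrib,
    Measure.dirac_apply' _ (MeasurableSet.univ_pi hs)]
  congr 1
  simp_rw [fun i => Measure.dirac_apply' (Pi.single (ω i) (1 : ℝ) : Fin k → ℝ) (hs i)]
  classical
  simp only [Set.indicator_apply, Pi.one_apply, Set.mem_univ_pi]
  rw [Finset.prod_boole]
  simp

lemma prod_linForm_eq {n k : ℕ} (p : Fin n → Fin k → ℝ) :
    ∏ i, linForm (p i) = ∑ ω : Fin n → Fin k,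
      MvPolynomial.monomial (∑ i, Finsupp.single (ω i) 1) (∏ i, p i (ω i)) := by
  simp only [linForm]
  rw [Finset.prod_univ_sum, Fintype.piFinset_univ]
  exact Finset.sum_congr rfl fun ω _ => (MvPolynomial.monomial_sum_prod _ _ _).symm

/-- The index set `V` is left free so that two laws can be written as sums over the same set and
subtracted termwise. -/
lemma multinomialLaw_real {n k : ℕ} {p : Fin n → Fin k → ℝ}
    (hp : ∀ i, p i ∈ stdSimplex ℝ (Fin k)) {S : Set (Fin k → ℝ)} (hS : MeasurableSet S)
    {V : Finset (Fin k →₀ ℕ)}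
    (hV : ∀ ω : Fin n → Fin k, ∑ i, Finsupp.single (ω i) 1 ∈ V) :
    (multinomialLaw p).real S = ∑ v ∈ V, (∏ i, linForm (p i)).coeff v *
      S.indicator (fun _ => (1 : ℝ)) fun j => (v j : ℝ) := by
  classical
  have hmeas : Measurable fun z : Fin n → Fin k → ℝ => ∑ i, z i := by fun_prop
  have hpre := hmeas hS
  have h1 : (multinomialLaw p).real S = ∑ ω : Fin n → Fin k, (∏ i, p i (ω i)) *
      S.indicator (fun _ => (1 : ℝ)) (∑ i, (Pi.single (ω i) 1 : Fin k → ℝ)) := by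
    rw [Measure.real, multinomialLaw, Measure.map_apply hmeas hS, pi_categoricalLaw hp]
    simp only [Measure.coe_finsetSum, Finset.sum_apply, Measure.smul_apply, smul_eq_mul]
    rw [ENNReal.toReal_sum fun ω _ => ENNReal.mul_ne_top ENNReal.ofReal_ne_top
      (measure_ne_top _ _)]
    refine Finset.sum_congr rfl fun ω _ => ?_
    rw [ENNReal.toReal_mul, ENNReal.toReal_ofReal (Finset.prod_nonneg fun i _ => (hp i).1 _),
      Measure.dirac_apply' _ hpre]
    congr 1
    simp only [Set.indicator_apply, Set.mem_preimage, Pi.one_apply]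
    split_ifs <;> simp
  rw [h1, prod_linForm_eq]
  simp_rw [MvPolynomial.coeff_sum, MvPolynomial.coeff_monomial, Finset.sum_mul]
  rw [Finset.sum_comm]
  refine Finset.sum_congr rfl fun ω _ => ?_
  simp_rw [ite_mul, zero_mul]
  rw [Finset.sum_ite_eq V, if_pos (hV ω)]
  congr 2
  ext j
  simp [Finset.sum_apply, Finsupp.single_apply, Pi.single_apply, Finsupp.finsetSum_apply, eq_comm]

lemma tvDist_multinomialLaw_le {n k : ℕ} {p q : Fin n → Fin k → ℝ}
    (hp : ∀ i, p i ∈ stdSimplex ℝ (Fin k)) (hq : ∀ i, q i ∈ stdSimplex ℝ (Fin k)) :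
    tvDist (multinomialLaw p) (multinomialLaw q) ≤
      coeffNorm (∏ i, linForm (p i) - ∏ i, linForm (q i)) := by
  classical
  have : Nonempty {S : Set (Fin k → ℝ) // MeasurableSet S} := ⟨⟨∅, MeasurableSet.empty⟩⟩
  refine ciSup_le fun ⟨S, hS⟩ => ?_
  set D := ∏ i, linForm (p i) - ∏ i, linForm (q i) with hD
  set V := (Finset.univ.image fun ω : Fin n → Fin k => ∑ i, Finsupp.single (ω i) 1) ∪ D.support
    with hVdef
  have hV : ∀ ω : Fin n → Fin k, ∑ i, Finsupp.single (ω i) 1 ∈ V := fun ω =>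
    Finset.mem_union_left _ (Finset.mem_image_of_mem _ (Finset.mem_univ ω))
  dsimp only
  rw [multinomialLaw_real hp hS hV, multinomialLaw_real hq hS hV, ← Finset.sum_sub_distrib,
    coeffNorm_eq_sum D (Finset.subset_union_right : D.support ⊆ V)]
  refine (Finset.abs_sum_le_sum_abs _ _).trans (Finset.sum_le_sum fun v _ => ?_)
  rw [← sub_mul, ← MvPolynomial.coeff_sub, abs_mul]
  refine mul_le_of_le_one_right (abs_nonneg _) ?_
  rw [Set.indicator_apply]
  split_ifs <;> simp

/-- The coordinate variables on the product of categorical laws. -/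
lemma isPMDDecomposition_pi {n k : ℕ} {q : Fin n → Fin k → ℝ}
    (hq : ∀ i, q i ∈ stdSimplex ℝ (Fin k)) :
    IsPMDDecomposition (fun z : Fin n → Fin k → ℝ => ∑ i, z i) (fun i z => z i)
      (Measure.pi fun i => categoricalLaw (q i)) := by
  have := fun i => isProbabilityMeasure_categoricalLaw (hq i)
  refine ⟨fun i => ⟨measurable_pi_apply i, ?_⟩, ?_, ?_⟩
  · have hS : MeasurableSet {y : Fin k → ℝ | ∃ j : Fin k, y = Pi.single j 1} := by
      refine Set.Finite.measurableSet ?_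
      exact (Set.finite_range fun j : Fin k => (Pi.single j 1 : Fin k → ℝ)).subset
        fun y ⟨j, hj⟩ => ⟨j, hj.symm⟩
    have hcat : ∀ᵐ y ∂categoricalLaw (q i), ∃ j : Fin k, y = Pi.single j 1 := by
      rw [ae_iff]
      have hc : MeasurableSet {y : Fin k → ℝ | ¬ ∃ j : Fin k, y = Pi.single j 1} := hS.compl
      simp only [categoricalLaw, Measure.coe_finsetSum, Finset.sum_apply, Measure.smul_apply,
        smul_eq_mul]
      refine Finset.sum_eq_zero fun j _ => ?_
      rw [Measure.dirac_apply' _ hc, Set.indicator_of_notMem, mul_zero]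
      exact fun h => h ⟨j, rfl⟩
    exact (measurePreserving_eval (fun i => categoricalLaw (q i)) i).quasiMeasurePreserving.ae hcat
  · exact iIndepFun_pi (X := fun _ y => y) fun i => aemeasurable_id
  · ext z
    simp [Finset.sum_apply]

lemma exists_pmd_of_rows {n k : ℕ} (q : Fin n → Fin k → ℝ)
    (hq : ∀ i, q i ∈ stdSimplex ℝ (Fin k)) :
    ∃ (Ω' : Type) (_ : MeasurableSpace Ω') (ν : Measure Ω') (_ : IsProbabilityMeasure ν)
      (Y : Ω' → Fin k → ℝ) (Z : Fin n → Ω' → Fin k → ℝ),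
      IsPMDDecomposition Y Z ν ∧ ν.map Y = multinomialLaw q ∧
      (Set.range fun i : Fin n => ν.map (Z i)).ncard ≤ (Set.range q).ncard := by
  have := fun i => isProbabilityMeasure_categoricalLaw (hq i)
  refine ⟨Fin n → Fin k → ℝ, inferInstance, Measure.pi fun i => categoricalLaw (q i),
    inferInstance, _, _, isPMDDecomposition_pi hq, rfl, ?_⟩
  have h : ∀ i, (Measure.pi fun i => categoricalLaw (q i)).map (fun z : Fin n → Fin k → ℝ => z i) =
      categoricalLaw (q i) := fun i =>
    (measurePreserving_eval (fun i => categoricalLaw (q i)) i).map_eq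
  simp_rw [h]
  rw [show (fun i => categoricalLaw (q i)) = categoricalLaw ∘ q from rfl, Set.range_comp]
  exact Set.ncard_image_le (Set.finite_range q)

lemma isProbabilityMeasure_multinomialLaw {n k : ℕ} {p : Fin n → Fin k → ℝ}
    (hp : ∀ i, p i ∈ stdSimplex ℝ (Fin k)) : IsProbabilityMeasure (multinomialLaw p) := by
  have := fun i => isProbabilityMeasure_categoricalLaw (hp i)
  exact Measure.isProbabilityMeasure_map (by fun_prop)

lemma tvDist_le_one {α : Type*} [MeasurableSpace α] (P Q : Measure α) [IsProbabilityMeasure P]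
    [IsProbabilityMeasure Q] : tvDist P Q ≤ 1 := by
  have : Nonempty {S : Set α // MeasurableSet S} := ⟨⟨∅, MeasurableSet.empty⟩⟩
  refine ciSup_le fun S => abs_le.2 ⟨?_, ?_⟩
  · linarith [measureReal_nonneg (μ := P) (s := S), measureReal_le_one (μ := Q) (s := S)]
  · linarith [measureReal_nonneg (μ := Q) (s := S), measureReal_le_one (μ := P) (s := S)]

lemma exists_rows_tvDist_le {n k : ℕ} (hk : 2 < k) {ε : ℝ} (hε : 0 < ε)
    (hεk : ε < (k : ℝ) / Real.exp 1) {p : Fin n → Fin k → ℝ}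
    (hp : ∀ i, p i ∈ stdSimplex ℝ (Fin k)) :
    ∃ q : Fin n → Fin k → ℝ, (∀ i, q i ∈ stdSimplex ℝ (Fin k)) ∧
      tvDist (multinomialLaw p) (multinomialLaw q) ≤ ε ∧
      ((Set.range q).ncard : ℝ) ≤
        (200000 * (Real.log (k / ε) / Real.log (Real.log (k / ε)) + k)) ^ k := by
  have hkR : (3 : ℝ) ≤ k := by exact_mod_cast hk
  have hk0 : (0 : ℝ) < k := by linarith
  set L := Real.log (k / ε) with hLdef
  have hL : 1 < L := by
    rw [hLdef, Real.lt_log_iff_exp_lt (by positivity), lt_div_iff₀ hε]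
    rwa [lt_div_iff₀ (Real.exp_pos 1), mul_comm] at hεk
  have hexp : Real.exp L = k / ε := Real.exp_log (by positivity)
  have hR0 : 0 < L / Real.log L := div_pos (by linarith) (Real.log_pos hL)
  -- For `ε ≥ 1` any PMD is close enough, and one with identical rows is taken. For `ε < 1`, `exp L
  -- = k / ε ≥ k`, as the group estimate requires, and the `k` groups lose `k * exp (-L) = ε` in
  -- total.
  rcases le_or_gt 1 ε with h1 | h1
  · have hx : (Pi.single ⟨0, by omega⟩ 1 : Fin k → ℝ) ∈ stdSimplex ℝ (Fin k) :=
      single_mem_stdSimplex ℝ _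
    have := isProbabilityMeasure_multinomialLaw hp
    have := isProbabilityMeasure_multinomialLaw (n := n) fun _ => hx
    refine ⟨fun _ => _, fun _ => hx, (tvDist_le_one _ _).trans h1, ?_⟩
    refine le_trans ?_ (one_le_pow₀ (by linarith : (1 : ℝ) ≤ 200000 * (L / Real.log L + k)))
    have h2 : (Set.range fun _ : Fin n => (Pi.single ⟨0, by omega⟩ 1 : Fin k → ℝ)).ncard ≤ 1 :=
      (Set.ncard_le_one (Set.finite_range _)).2 (by rintro _ ⟨_, rfl⟩ _ ⟨_, rfl⟩; rfl)
    exact_mod_cast h2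
  · have hkL : (k : ℝ) ≤ Real.exp L := by
      rw [hexp, le_div_iff₀ hε]; nlinarith
    obtain ⟨q, hq, hnorm, hcard⟩ := exists_few_values_le_mul hk hL hkL
      (Nat.le_ceil (8 * (L / Real.log L + k))) p hp
    refine ⟨q, hq, (tvDist_multinomialLaw_le hp hq).trans (hnorm.trans (le_of_eq ?_)),
      hcard.trans (count_le hk hL (Nat.ceil_lt_add_one (by positivity)).le)⟩
    rw [Real.exp_neg, hexp]
    field_simp

theorem mainTheorem8 :
    ∃ C : ℝ, 0 < C ∧
      ∀ (n k : ℕ), 2 < k →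
      ∀ ε : ℝ, 0 < ε → ε < (k : ℝ) / Real.exp 1 →
      ∀ {Ω : Type*} [MeasurableSpace Ω] (μ : Measure Ω) [IsProbabilityMeasure μ]
        (X : Ω → Fin k → ℝ), IsPMD n X μ →
      ∃ (Ω' : Type) (_ : MeasurableSpace Ω') (ν : Measure Ω') (_ : IsProbabilityMeasure ν)
        (Y : Ω' → Fin k → ℝ) (Z : Fin n → Ω' → Fin k → ℝ),
        IsPMDDecomposition Y Z ν ∧
        tvDist (μ.map X) (ν.map Y) ≤ ε ∧
        ((Set.range fun i : Fin n => ν.map (Z i)).ncard : ℝ) ≤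
          (C * (Real.log (k / ε) / Real.log (Real.log (k / ε)) + k)) ^ k := by
  refine ⟨200000, by norm_num, fun n k hk ε hε hεk Ω _ μ _ X hX => ?_⟩
  obtain ⟨p, hp, hmap⟩ := hX.exists_map_eq
  obtain ⟨q, hq, htv, hcard⟩ := exists_rows_tvDist_le hk hε hεk hp
  obtain ⟨Ω', mΩ', ν, hν, Y, Z, hdec, hY, hle⟩ := exists_pmd_of_rows q hq
  refine ⟨Ω', mΩ', ν, hν, Y, Z, hdec, by rwa [hmap, hY], le_trans ?_ hcard⟩
  exact_mod_cast hle
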